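/- Let $\gamma>0$ and put $\alpha=\frac{\gamma}{1-e^{-\gamma}}-\frac{\gamma}{1-e^{\gamma}}=\gamma\coth(\gamma/2)$, $\eta=\frac{-\gamma}{1-e^{-\gamma}}$, $\beta=\frac{\gamma}{1-e^{\gamma}}$. For $N\ge1$ let $C^\gamma\in\mathbb R^{2N\times2N}$ be the tridiagonal matrix whose diagonal entries are $\alpha$, except that the $(1,1)$ and $(2N,2N)$ entries are $\alpha+\beta$, whose rows $1,\dots,N$ have $\beta$ immediately left and $\eta$ immediately right of the diagonal, and whose rows $N+1,\dots,2N$ have $\eta$ immediately left and $\beta$ immediately right of the diagonal. For $\theta\in\mathbb R$ let $\mathcal C^{\theta,\gamma}=\operatorname{diag}(e^{i\theta}I_N,e^{-i\theta}I_N)\,C^\gamma$. For $\phi\in[0,2\pi]$ let $f^\theta_\pm(e^{i\phi})=e^{\pm i\theta}\bigl(\beta e^{\pm i\phi}+\alpha+\eta e^{\mp i\phi}\bigr)$, and let $$E^{\theta}=\{z\in\mathbb C:\operatorname{wind}(f^\theta_+,z)<0\},\qquad E^{-\theta}=\{z\in\mathbb C:-\operatorname{wind}(f^\theta_-,z)<0\},$$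 where $\operatorname{wind}(f,z)$ is the winding number of the loop $\phi\mapsto f(e^{i\phi})$ around a point $z$ not on the loop (points on the loop belong to neither set). Fix $\sigma>0$ and let $\Theta=\{z:\operatorname{dist}(z,\partial E^\theta\cup\partial E^{-\theta})<\sigma\}$. An eigenpair $(\lambda,\boldsymbol v)$ of $\mathcal C^{\theta,\gamma}$ consists of $\lambda\in\mathbb C$ and $\boldsymbol v\in\mathbb C^{2N}\setminus\{0\}$ with $\mathcal C^{\theta,\gamma}\boldsymbol v=\lambda\boldsymbol v$; $\boldsymbol v^{(j)}$ is its $j$-th entry. **Theorem.** Let $0<\theta<\pi/2$. There are $N_0\in\mathbb N$ and $B,C>0$, depending only on $\gamma,\theta,\sigma$, such that the following holds. For $N\ge N_0$ every eigenvalue $\lambda$ of $\mathcal C^{\theta,\gamma}$ satisfies exactly one of: (1) $\lambda\in\Theta$; (2) $\lambda\in(E^\theta\cap E^{-\theta})\setminus\Theta$; (3) $\lambda\in(E^\theta\,\triangle\,E^{-\theta})\setminus\Theta$. Moreover: 1. $0\in\Theta$, and for every $N$ the kernel of $\mathcal C^{\theta,\gamma}$ is spanned by $\boldsymbol 1=(1,\dots,1)^\top$.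 (Nothing is claimed about other $\lambda\in\Theta$.) 2. For every $N\ge1$ and every eigenpair $(\lambda,\boldsymbol v)$ with $\lambda\in(E^\theta\cap E^{-\theta})\setminus\Theta$, for $1\le j\le N$, $$|\boldsymbol v^{(j)}|<C\,e^{-B\frac{j\gamma}{2}}\,|\boldsymbol v^{(1)}|,\qquad |\boldsymbol v^{(2N+1-j)}|<C\,e^{-B\frac{j\gamma}{2}}\,|\boldsymbol v^{(2N)}| .$$ If in addition $N\ge N_0$, then $|\boldsymbol v^{(2N)}|\le|\boldsymbol v^{(1)}|$ when $\operatorname{Im}\lambda\ge0$, and $|\boldsymbol v^{(1)}|\le|\boldsymbol v^{(2N)}|$ when $\operatorname{Im}\lambda\le0$. For every $N\ge 1$ and every eigenpair with real $\lambda$ the decay is symmetric: $|\boldsymbol v^{(j)}|=|\boldsymbol v^{(2N+1-j)}|$ for $1\le j\le N$. 3. For every $N\ge1$ and every eigenpair $(\lambda,\boldsymbol v)$ with $\lambda\in(E^\theta\,\triangle\,E^{-\theta})\setminus\Theta$, for $1\le j\le 2N$, $$|\boldsymbol v^{(j)}|<C\,e^{-B\frac{j\gamma}{2}}\,|\boldsymbol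 v^{(1)}|\ \text{ if }\lambda\in E^\theta,\qquad |\boldsymbol v^{(2N+1-j)}|<C\,e^{-B\frac{j\gamma}{2}}\,|\boldsymbol v^{(2N)}|\ \text{ if }\lambda\in E^{-\theta}.$$ Finally, for every $\theta$ with $\frac\pi4\le\theta\le\frac\pi2$ there is $N_0$ (depending only on $\gamma,\theta,\sigma$) such that for $N\ge N_0$ no eigenvalue of $\mathcal C^{\theta,\gamma}$ lies in $(E^\theta\cap E^{-\theta})\setminus\Theta$. -/

import Mathlib

namespace GaugeCapacitance

noncomputable section

/-- The coefficient `α = γ / (1 - e^{-γ}) - γ / (1 - e^γ) = γ coth (γ / 2)`. -/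
def alpha (γ : ℝ) : ℝ := γ / (1 - Real.exp (-γ)) - γ / (1 - Real.exp γ)

/-- The coefficient `η = -γ / (1 - e^{-γ})`. -/
def eta (γ : ℝ) : ℝ := -γ / (1 - Real.exp (-γ))

/-- The coefficient `β = γ / (1 - e^γ)`. -/
def beta (γ : ℝ) : ℝ := γ / (1 - Real.exp γ)

/-- The real tridiagonal `2N × 2N` gauge capacitance matrix `C^γ`. With rows and columns numbered
from `0`: the diagonal is `α`, except for `α + β` in the two corners; the first `N` rows carry
`β` below and `η` above the diagonal, and the last `N` rows `η` below and `β` above it. -/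
def capMatrix (N : ℕ) (γ : ℝ) : Matrix (Fin (2 * N)) (Fin (2 * N)) ℝ :=
  Matrix.of fun i j =>
    if i = j then
      if (i : ℕ) = 0 ∨ (i : ℕ) + 1 = 2 * N then alpha γ + beta γ else alpha γ
    else if (j : ℕ) = (i : ℕ) + 1 then
      if (i : ℕ) < N then eta γ else beta γ
    else if (i : ℕ) = (j : ℕ) + 1 then
      if (i : ℕ) < N then beta γ else eta γ
    else 0

/-- The diagonal matrix `V^θ = diag (e^{iθ} I_N, e^{-iθ} I_N)`. -/
def gainLossMatrix (N : ℕ) (θ : ℝ) : Matrix (Fin (2 * N)) (Fin (2 * N)) ℂ :=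
  Matrix.diagonal fun i =>
    if (i : ℕ) < N then Complex.exp (Complex.I * θ) else Complex.exp (-(Complex.I * θ))

/-- The generalised gauge capacitance matrix `𝒞^{θ,γ} = V^θ C^γ`. -/
def genCapMatrix (N : ℕ) (θ γ : ℝ) : Matrix (Fin (2 * N)) (Fin (2 * N)) ℂ :=
  gainLossMatrix N θ * (capMatrix N γ).map Complex.ofReal

/-- `(lam, v)` is an eigenpair of `𝒞^{θ,γ}`: `v ≠ 0` and `𝒞^{θ,γ} v = lam v`. -/
def IsEigenpair (N : ℕ) (θ γ : ℝ) (lam : ℂ) (v : Fin (2 * N) → ℂ) : Prop :=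
  v ≠ 0 ∧ (genCapMatrix N θ γ).mulVec v = lam • v

/-- The entry `v^{(j)}` of `v ∈ ℂ^{2N}`, with the entries numbered `1, …, 2N`. -/
def entry {N : ℕ} (v : Fin (2 * N) → ℂ) (j : ℕ) : ℂ :=
  if h : 1 ≤ j ∧ j ≤ 2 * N then v ⟨j - 1, by omega⟩ else 0

/-- The upper symbol `f_+^θ (e^{iφ}) = e^{iθ} (β e^{iφ} + α + η e^{-iφ})`. -/
def symbolUpper (θ γ : ℝ) (w : Circle) : ℂ :=
  Complex.exp (Complex.I * θ) * (beta γ * (w : ℂ) + alpha γ + eta γ * (w : ℂ)⁻¹)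

/-- The lower symbol `f_-^θ (e^{iφ}) = e^{-iθ} (β e^{-iφ} + α + η e^{iφ})`. -/
def symbolLower (θ γ : ℝ) (w : Circle) : ℂ :=
  Complex.exp (-(Complex.I * θ)) * (beta γ * (w : ℂ)⁻¹ + alpha γ + eta γ * (w : ℂ))

/-- The loop `φ ↦ f (e^{iφ})`, `0 ≤ φ ≤ 2π`, avoids `z` and winds `n` times around `z`: there is a
continuous logarithm `g` of `f (e^{iφ}) - z`, and it increases by `2πi n` over one period. (This
cannot hold when `z` lies on the loop, since the exponential has no zeros.) -/
def HasWindingNumber (f : Circle → ℂ) (z : ℂ) (n : ℤ) : Prop :=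
  ∃ g : ℝ → ℂ, Continuous g ∧
    (∀ φ : ℝ, Complex.exp (g φ) = f (Circle.exp φ) - z) ∧
    g (2 * Real.pi) - g 0 = 2 * Real.pi * Complex.I * n

/-- The upper region of topological convergence `E^θ = {z | wind (f_+^θ, z) < 0}`. -/
def regionUpper (θ γ : ℝ) : Set ℂ :=
  {z | ∃ n : ℤ, HasWindingNumber (symbolUpper θ γ) z n ∧ n < 0}

/-- The lower region of topological convergence `E^{-θ} = {z | -wind (f_-^θ, z) < 0}`. -/
def regionLower (θ γ : ℝ) : Set ℂ :=
  {z | ∃ n : ℤ, HasWindingNumber (symbolLower θ γ) z n ∧ -n < 0}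

/-- The open `σ`-neighbourhood `Θ` of `∂E^θ ∪ ∂E^{-θ}`. -/
def boundaryLayer (θ γ σ : ℝ) : Set ℂ :=
  Metric.thickening σ (frontier (regionUpper θ γ) ∪ frontier (regionLower θ γ))

end

end GaugeCapacitance

/-! Put `q = e^γ`, `b = coupling γ`, `m = e^{-iθ} λ / b` and `m' = e^{iθ} λ / b`. In the left half
of the chain the eigenvalue equation is a three-term recurrence with parameter `m`, so `v_j = p_j(m)
v_1` with the polynomials `p_n = edgePoly q n`. Reversal of the chain changes `θ` to `-θ`, so the
right half is `p_j(m') v_{2N}` counted from the other end. Both descriptions hold at the sites `N`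
and `N+1`. This gluing ties `v_1` to `v_{2N}` and yields `p_{N+1}(m) p_{N+1}(m') = p_N(m) p_N(m')`.

The symbol factors through the characteristic roots, `|z₁| ≤ |z₂|` and `|z₁ z₂| = 1/q`, and its
winding number shows that `λ ∈ E^θ` iff `|z₂| < 1` (`mem_regionUpper_iff`). Outside `Θ` the modulus
of `z₂` differs from `1` by a fixed gap (`abs_norm_sub_one_ge`). Hence `p_n` decays geometrically
inside a region, uniformly in `λ`, and outside it eventually increases in modulus. If `λ` is outside
both regions, the characteristic equation fails for large `N`. If it is inside just one, gluing
carries the decay across the interface (`IsEigenpair.norm_entry_le`). If it is inside both and `π/4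
≤ θ ≤ π/2`, the angle `2θ` between `m` and `m'` pushes both off the real axis. The two roots then
separate in modulus, both sequences `|p_n|` eventually decrease, and the characteristic equation
fails again.

The dominating edge comes from the zeros of `p_n`, which are all positive: `m` and `m'` have equal
modulus, so `|p_n|` is smaller at the one with the larger real part (`norm_edgeVal_mono`). -/

namespace GaugeCapacitance

/-! ### Edge polynomials, characteristic roots and growth estimates -/

open Polynomial

/-- The polynomials `p_n` with `p_0 = p_1 = 1` and `q p_{n+2} = (1 + q - X) p_{n+1} - p_n`. -/
noncomputable def edgePoly (q : ℝ) : ℕ → ℂ[X]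
  | 0 => 1
  | 1 => 1
  | n + 2 => C ((q : ℂ)⁻¹) * ((C (1 + (q : ℂ)) - X) * edgePoly q (n + 1) - edgePoly q n)

/-- The value of `edgePoly q n` at `m`. -/
noncomputable def edgeVal (q : ℝ) (m : ℂ) (n : ℕ) : ℂ := (edgePoly q n).eval m

/-- `z₁, z₂` are the roots of `q z² - (1 + q - m) z + 1`, in order of modulus. -/
structure CharRoots (q : ℝ) (m z₁ z₂ : ℂ) : Prop where
  sum : q * (z₁ + z₂) = 1 + q - m
  prod : q * (z₁ * z₂) = 1
  le : ‖z₁‖ ≤ ‖z₂‖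

@[simp] lemma edgeVal_zero (q : ℝ) (m : ℂ) : edgeVal q m 0 = 1 := by simp [edgeVal, edgePoly]

@[simp] lemma edgeVal_one (q : ℝ) (m : ℂ) : edgeVal q m 1 = 1 := by simp [edgeVal, edgePoly]

lemma edgeVal_add_two {q : ℝ} (hq : 1 < q) (m : ℂ) (n : ℕ) :
    q * edgeVal q m (n + 2) = (1 + q - m) * edgeVal q m (n + 1) - edgeVal q m n := by
  have : (q : ℂ) ≠ 0 := by exact_mod_cast (by linarith : q ≠ 0)
  simp only [edgeVal, edgePoly, eval_mul, eval_C, eval_sub, eval_X]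
  field_simp

lemma edgeVal_at_zero {q : ℝ} (hq : 1 < q) (n : ℕ) : edgeVal q 0 n = 1 := by
  have h0 : (q : ℂ) ≠ 0 := by exact_mod_cast (by linarith : q ≠ 0)
  suffices h : edgeVal q 0 n = 1 ∧ edgeVal q 0 (n + 1) = 1 from h.1
  induction n with
  | zero => simp
  | succ n ih =>
    refine ⟨ih.2, mul_left_cancel₀ h0 ?_⟩
    rw [edgeVal_add_two hq, ih.1, ih.2]; ring

lemma edgeVal_conj {q : ℝ} (hq : 1 < q) (m : ℂ) (n : ℕ) :
    edgeVal q (starRingEnd ℂ m) n = starRingEnd ℂ (edgeVal q m n) := by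
  have h0 : (q : ℂ) ≠ 0 := by exact_mod_cast (by linarith : q ≠ 0)
  suffices h : edgeVal q (starRingEnd ℂ m) n = starRingEnd ℂ (edgeVal q m n) ∧
    edgeVal q (starRingEnd ℂ m) (n + 1) = starRingEnd ℂ (edgeVal q m (n + 1)) from h.1
  induction n with
  | zero => simp
  | succ n ih =>
    refine ⟨ih.2, mul_left_cancel₀ h0 ?_⟩
    have := congrArg (starRingEnd ℂ) (edgeVal_add_two hq m n)
    simp only [map_mul, map_sub, map_add, map_one, Complex.conj_ofReal] at this
    rw [edgeVal_add_two hq, ih.1, ih.2, this]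

/-- Two consecutive zeros would propagate backwards to `p_0 = 1`. -/
lemma edgeVal_pair_ne_zero {q : ℝ} (hq : 1 < q) (m : ℂ) (n : ℕ) :
    edgeVal q m n ≠ 0 ∨ edgeVal q m (n + 1) ≠ 0 := by
  induction n with
  | zero => simp
  | succ n ih =>
    by_contra! h
    have := edgeVal_add_two hq m n
    rw [h.1, h.2] at this
    rcases ih with ih | ih
    · apply ih; linear_combination this
    · exact ih h.1

lemma exists_charRoots {q : ℝ} (hq : 1 < q) (m : ℂ) : ∃ z₁ z₂, CharRoots q m z₁ z₂ := by
  have h0 : (q : ℂ) ≠ 0 := by exact_mod_cast (by linarith : q ≠ 0)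
  obtain ⟨s, hs⟩ := IsAlgClosed.exists_pow_nat_eq ((1 + q - m) ^ 2 - 4 * q) (n := 2) (by norm_num)
  have h : ∀ t : ℂ, t ^ 2 = (1 + q - m) ^ 2 - 4 * q →
      (q : ℂ) * ((1 + q - m + t) / (2 * q) + (1 + q - m - t) / (2 * q)) = 1 + q - m ∧
      (q : ℂ) * ((1 + q - m + t) / (2 * q) * ((1 + q - m - t) / (2 * q))) = 1 := by
    intro t ht
    constructor
    · field_simp; ring
    · field_simp; linear_combination -ht
  rcases le_total ‖(1 + q - m + s) / (2 * q)‖ ‖(1 + q - m - s) / (2 * q)‖ with hle | hle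
  · exact ⟨_, _, (h s hs).1, (h s hs).2, hle⟩
  · exact ⟨_, _, by rw [add_comm]; exact (h s hs).1, by rw [mul_comm (_ / _)]; exact (h s hs).2, hle⟩

namespace CharRoots

variable {q : ℝ} {m z₁ z₂ : ℂ}

lemma norm_prod (h : CharRoots q m z₁ z₂) (hq : 1 < q) : q * (‖z₁‖ * ‖z₂‖) = 1 := by
  have := congrArg norm h.prod
  rwa [norm_mul, norm_mul, norm_one, Complex.norm_real, Real.norm_of_nonneg (by linarith)] at this

lemma pos_fst (h : CharRoots q m z₁ z₂) : 0 < ‖z₁‖ := by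
  rw [norm_pos_iff]; rintro rfl; simpa using h.prod

lemma pos_snd (h : CharRoots q m z₁ z₂) : 0 < ‖z₂‖ :=
  h.pos_fst.trans_le h.le

lemma one_le_sq (h : CharRoots q m z₁ z₂) (hq : 1 < q) : 1 ≤ q * ‖z₂‖ ^ 2 := by
  have h1 := h.norm_prod hq
  have h2 := mul_le_mul_of_nonneg_right h.le (norm_nonneg z₂)
  nlinarith

lemma one_lt_mul (h : CharRoots q m z₁ z₂) (hq : 1 < q) : 1 < q * ‖z₂‖ := by
  have h1 := h.one_le_sq hq
  by_contra! h2
  have h3 := h.pos_snd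
  nlinarith

lemma norm_fst_lt_one (h : CharRoots q m z₁ z₂) (hq : 1 < q) : ‖z₁‖ < 1 := by
  have h1 := h.norm_prod hq
  have h2 := h.one_lt_mul hq
  have h3 := h.pos_fst
  nlinarith

lemma eq_param_snd (h : CharRoots q m z₁ z₂) : m = 1 + q - q * z₂ - z₂⁻¹ := by
  have hz : z₂ ≠ 0 := by rintro rfl; simpa using h.prod
  have h1 : z₂⁻¹ = q * z₁ := by
    rw [inv_eq_iff_eq_inv]; exact eq_inv_of_mul_eq_one_left (by linear_combination h.prod)
  rw [h1]; linear_combination h.sum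

/-- Removing the `z₁` mode leaves a geometric sequence. Unlike `binet`, this still carries
information when `z₁ = z₂`. -/
lemma step_fst (h : CharRoots q m z₁ z₂) (hq : 1 < q) (n : ℕ) :
    edgeVal q m (n + 1) - z₁ * edgeVal q m n = (1 - z₁) * z₂ ^ n := by
  have h0 : (q : ℂ) ≠ 0 := by exact_mod_cast (by linarith : q ≠ 0)
  induction n with
  | zero => simp
  | succ n ih =>
    apply mul_left_cancel₀ h0
    rw [pow_succ]
    linear_combination edgeVal_add_two hq m n - edgeVal q m (n + 1) * h.sum
      + q * z₂ * ih + edgeVal q m n * h.prod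

lemma step_snd (h : CharRoots q m z₁ z₂) (hq : 1 < q) (n : ℕ) :
    edgeVal q m (n + 1) - z₂ * edgeVal q m n = (1 - z₂) * z₁ ^ n := by
  have h0 : (q : ℂ) ≠ 0 := by exact_mod_cast (by linarith : q ≠ 0)
  induction n with
  | zero => simp
  | succ n ih =>
    apply mul_left_cancel₀ h0
    rw [pow_succ]
    linear_combination edgeVal_add_two hq m n - edgeVal q m (n + 1) * h.sum
      + q * z₁ * ih + edgeVal q m n * h.prod

lemma binet (h : CharRoots q m z₁ z₂) (hq : 1 < q) (n : ℕ) :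
    (z₂ - z₁) * edgeVal q m n = (1 - z₁) * z₂ ^ n - (1 - z₂) * z₁ ^ n := by
  linear_combination h.step_fst hq n - h.step_snd hq n

/-- The first-order recursion `step_fst` avoids division by `z₂ - z₁`, so the bound is uniform up to
double roots. The rate `1 - δ/2` instead of `1 - δ` absorbs the linear factor of a double root, and
`K = 4/δ` solves `(1 - δ) K + 2 = (1 - δ/2) K`. -/
lemma norm_edgeVal_le (h : CharRoots q m z₁ z₂) (hq : 1 < q) {δ : ℝ} (hδ : 0 < δ)
    (hz : ‖z₂‖ ≤ 1 - δ) (n : ℕ) : ‖edgeVal q m n‖ ≤ 4 / δ * (1 - δ / 2) ^ n := by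
  have hz0 := h.pos_snd
  have h1 := h.le
  have h2 := h.pos_fst
  have hK : 4 ≤ 4 / δ := by rw [le_div_iff₀ hδ]; linarith
  induction n with
  | zero => simp; linarith
  | succ n ih =>
    have e : edgeVal q m (n + 1) = z₁ * edgeVal q m n + (1 - z₁) * z₂ ^ n := by
      linear_combination h.step_fst hq n
    have hp : ‖z₂‖ ^ n ≤ (1 - δ / 2) ^ n := by gcongr; linarith
    have h3 : ‖(1 : ℂ) - z₁‖ ≤ 2 := by
      refine (norm_sub_le _ _).trans ?_; rw [norm_one]; linarith
    calc ‖edgeVal q m (n + 1)‖ ≤ ‖z₁‖ * ‖edgeVal q m n‖ + ‖1 - z₁‖ * ‖z₂‖ ^ n := by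
          rw [e]; refine (norm_add_le _ _).trans ?_; rw [norm_mul, norm_mul, norm_pow]
      _ ≤ (1 - δ) * (4 / δ * (1 - δ / 2) ^ n) + 2 * (1 - δ / 2) ^ n := by
          gcongr
          · linarith
          · linarith
      _ = 4 / δ * (1 - δ / 2) ^ (n + 1) := by rw [pow_succ]; field_simp; ring

/-- Here `|z₁| ≤ 1/q`, and the constant solves `K/q + 2 = K`. -/
lemma norm_edgeVal_le_pow (h : CharRoots q m z₁ z₂) (hq : 1 < q) (hz : 1 ≤ ‖z₂‖) (n : ℕ) :
    ‖edgeVal q m n‖ ≤ 2 * q / (q - 1) * ‖z₂‖ ^ n := by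
  have h2 := h.pos_fst
  have h4 : ‖z₁‖ ≤ 1 / q := by
    rw [le_div_iff₀ (by linarith)]; have := h.norm_prod hq; nlinarith
  have hq1 : 0 < q - 1 := by linarith
  induction n with
  | zero => simp; rw [le_div_iff₀ hq1]; linarith
  | succ n ih =>
    have e : edgeVal q m (n + 1) = z₁ * edgeVal q m n + (1 - z₁) * z₂ ^ n := by
      linear_combination h.step_fst hq n
    have h3 : ‖(1 : ℂ) - z₁‖ ≤ 2 := by
      refine (norm_sub_le _ _).trans ?_; rw [norm_one]; linarith [h.norm_fst_lt_one hq]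
    calc ‖edgeVal q m (n + 1)‖ ≤ ‖z₁‖ * ‖edgeVal q m n‖ + ‖1 - z₁‖ * ‖z₂‖ ^ n := by
          rw [e]; refine (norm_add_le _ _).trans ?_; rw [norm_mul, norm_mul, norm_pow]
      _ ≤ (1 / q) * (2 * q / (q - 1) * ‖z₂‖ ^ n) + 2 * ‖z₂‖ ^ n := by gcongr
      _ = 2 * q / (q - 1) * ‖z₂‖ ^ n := by field_simp; ring
      _ ≤ 2 * q / (q - 1) * ‖z₂‖ ^ (n + 1) := by
          refine mul_le_mul_of_nonneg_left ?_ (by positivity)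
          exact pow_le_pow_right₀ hz (by omega)

/-- In Binet's formula the `z₂` term grows by a factor `|z₂| ≥ 1 + δ`, while the `z₁` term is at
most `2 q^{-n}`. -/
lemma norm_edgeVal_lt_succ (h : CharRoots q m z₁ z₂) (hq : 1 < q) {δ : ℝ} (hδ : 0 < δ)
    (hz : 1 + δ ≤ ‖z₂‖) {n : ℕ} (hn : 1 ≤ n) (hs : (1 / q) ^ n < (1 - 1 / q) * δ / 4) :
    ‖edgeVal q m n‖ < ‖edgeVal q m (n + 1)‖ := by
  have h2 := h.pos_fst
  have hq0 : 0 < q := by linarith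
  have h4 : ‖z₁‖ ≤ 1 / q := by
    rw [le_div_iff₀ (by linarith)]; have := h.norm_prod hq; nlinarith
  have hq1 : 1 / q < 1 := by rw [div_lt_one hq0]; exact hq
  have ha : 1 - 1 / q ≤ ‖1 - z₁‖ := by
    have := norm_sub_norm_le (1 : ℂ) z₁; rw [norm_one] at this; linarith
  -- The factor `1 - z₂` is unbounded; one power of `z₁` pays for it because `|z₁ z₂| = 1/q`. This
  -- needs `n ≥ 1`.
  have hb : ‖1 - z₂‖ * ‖z₁‖ ^ n ≤ 2 * (1 / q) ^ n := by
    obtain ⟨k, rfl⟩ : ∃ k, n = k + 1 := ⟨n - 1, by omega⟩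
    have h5 : ‖1 - z₂‖ ≤ 1 + ‖z₂‖ := by
      refine (norm_sub_le _ _).trans ?_; rw [norm_one]
    have h6 : ‖z₂‖ * ‖z₁‖ = 1 / q := by
      rw [eq_div_iff hq0.ne']; linarith [h.norm_prod hq]
    calc ‖1 - z₂‖ * ‖z₁‖ ^ (k + 1) ≤ (1 + ‖z₂‖) * ‖z₁‖ ^ (k + 1) := by gcongr
      _ = ‖z₁‖ ^ (k + 1) + (‖z₂‖ * ‖z₁‖) * ‖z₁‖ ^ k := by ring
      _ ≤ (1 / q) ^ (k + 1) + (1 / q) * (1 / q) ^ k := by rw [h6]; gcongr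
      _ = _ := by ring
  have hpow : 1 ≤ ‖z₂‖ ^ n := one_le_pow₀ (by linarith)
  have h7 : 1 ≤ ‖1 - z₁‖ * ‖z₂‖ ^ n / (1 - 1 / q) := by
    rw [one_le_div (by linarith)]; nlinarith
  have hne : 0 < ‖z₂ - z₁‖ := by
    have := norm_sub_norm_le z₂ z₁; linarith
  have e1 := congrArg norm (h.binet hq n)
  have e2 := congrArg norm (h.binet hq (n + 1))
  have u1 : ‖(1 - z₁) * z₂ ^ n - (1 - z₂) * z₁ ^ n‖ ≤
      ‖1 - z₁‖ * ‖z₂‖ ^ n + ‖1 - z₂‖ * ‖z₁‖ ^ n := by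
    refine (norm_sub_le _ _).trans ?_; simp
  have u2 : ‖1 - z₁‖ * ‖z₂‖ ^ (n + 1) - ‖1 - z₂‖ * ‖z₁‖ ^ (n + 1) ≤
      ‖(1 - z₁) * z₂ ^ (n + 1) - (1 - z₂) * z₁ ^ (n + 1)‖ := by
    refine le_trans ?_ (norm_sub_norm_le _ _); simp
  rw [norm_mul] at e1 e2
  rw [← e1] at u1
  rw [← e2] at u2
  have u3 : ‖1 - z₂‖ * ‖z₁‖ ^ (n + 1) ≤ ‖1 - z₂‖ * ‖z₁‖ ^ n := by
    gcongr ?_ * ?_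
    exact pow_le_pow_of_le_one h2.le (by linarith) (by omega)
  have u4 : (1 - 1 / q) * δ ≤ ‖1 - z₁‖ * ‖z₂‖ ^ n * (‖z₂‖ - 1) := by
    have : 1 - 1 / q ≤ ‖1 - z₁‖ * ‖z₂‖ ^ n := by nlinarith
    exact mul_le_mul this (by linarith) hδ.le (by positivity)
  rw [pow_succ ‖z₂‖] at u2
  have : ‖z₂ - z₁‖ * ‖edgeVal q m n‖ < ‖z₂ - z₁‖ * ‖edgeVal q m (n + 1)‖ := by
    nlinarith
  exact lt_of_mul_lt_mul_left this hne.le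

/-- Inside the disc the two roots may have equal modulus, so dominance of the `z₂` term has to be
assumed through `κ`. -/
lemma norm_edgeVal_succ_lt (h : CharRoots q m z₁ z₂) (hq : 1 < q) {δ κ : ℝ} (hδ : 0 < δ)
    (hz : ‖z₂‖ ≤ 1 - δ) (hκ : κ < 1) (hzκ : ‖z₁‖ ≤ κ * ‖z₂‖) {n : ℕ} (hs : κ ^ n < δ ^ 2 / 4) :
    ‖edgeVal q m (n + 1)‖ < ‖edgeVal q m n‖ := by
  have h1 := h.pos_fst
  have h2 := h.pos_snd
  have ha : δ ≤ ‖1 - z₁‖ := by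
    have := norm_sub_norm_le (1 : ℂ) z₁; rw [norm_one] at this; linarith [h.le]
  have h5 : ‖1 - z₂‖ ≤ 2 := by
    refine (norm_sub_le _ _).trans ?_; rw [norm_one]; linarith
  have hpow : 0 < ‖z₂‖ ^ n := by positivity
  have hb : ‖1 - z₂‖ * ‖z₁‖ ^ n ≤ 2 * (κ ^ n * ‖z₂‖ ^ n) := by
    rw [← mul_pow]; gcongr
  have hne : 0 < ‖z₂ - z₁‖ := by
    have := norm_sub_norm_le z₂ z₁; nlinarith
  have e1 := congrArg norm (h.binet hq n)
  have e2 := congrArg norm (h.binet hq (n + 1))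
  have u1 : ‖(1 - z₁) * z₂ ^ (n + 1) - (1 - z₂) * z₁ ^ (n + 1)‖ ≤
      ‖1 - z₁‖ * ‖z₂‖ ^ (n + 1) + ‖1 - z₂‖ * ‖z₁‖ ^ (n + 1) := by
    refine (norm_sub_le _ _).trans ?_; simp
  have u2 : ‖1 - z₁‖ * ‖z₂‖ ^ n - ‖1 - z₂‖ * ‖z₁‖ ^ n ≤
      ‖(1 - z₁) * z₂ ^ n - (1 - z₂) * z₁ ^ n‖ := by
    refine le_trans ?_ (norm_sub_norm_le _ _); simp
  rw [norm_mul] at e1 e2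
  rw [← e2] at u1
  rw [← e1] at u2
  have u3 : ‖1 - z₂‖ * ‖z₁‖ ^ (n + 1) ≤ ‖1 - z₂‖ * ‖z₁‖ ^ n := by
    gcongr ?_ * ?_
    exact pow_le_pow_of_le_one h1.le (h.norm_fst_lt_one hq).le (by omega)
  have u4 : δ * δ ≤ ‖1 - z₁‖ * (1 - ‖z₂‖) :=
    mul_le_mul ha (by linarith) hδ.le (by positivity)
  have u5 : δ * δ * ‖z₂‖ ^ n ≤ ‖1 - z₁‖ * (1 - ‖z₂‖) * ‖z₂‖ ^ n :=
    mul_le_mul_of_nonneg_right u4 hpow.le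
  have u6 : κ ^ n * ‖z₂‖ ^ n < δ ^ 2 / 4 * ‖z₂‖ ^ n := mul_lt_mul_of_pos_right hs hpow
  rw [pow_succ ‖z₂‖] at u1
  have : ‖z₂ - z₁‖ * ‖edgeVal q m (n + 1)‖ < ‖z₂ - z₁‖ * ‖edgeVal q m n‖ := by
    nlinarith
  exact lt_of_mul_lt_mul_left this hne.le

end CharRoots

/-! ### Positivity of the zeros of the edge polynomials -/

/-- The weights `q^j` symmetrise the recurrence. Summation by parts leaves no term at the left end,
since `p_1 = p_0`. -/
lemma edgeVal_sum_by_parts {q : ℝ} (hq : 1 < q) (m : ℂ) (n : ℕ) :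
    m * ∑ j ∈ Finset.range n, (q : ℂ) ^ j * (‖edgeVal q m (j + 1)‖ : ℂ) ^ 2 =
      (∑ j ∈ Finset.range n, (q : ℂ) ^ (j + 1) *
        (‖edgeVal q m (j + 2) - edgeVal q m (j + 1)‖ : ℂ) ^ 2) -
      (q : ℂ) ^ n * (edgeVal q m (n + 1) - edgeVal q m n) *
        starRingEnd ℂ (edgeVal q m (n + 1)) := by
  induction n with
  | zero => simp
  | succ n ih =>
    rw [Finset.sum_range_succ, Finset.sum_range_succ, mul_add, ih]
    simp only [← Complex.mul_conj', map_sub]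
    have h := edgeVal_add_two hq m n
    rw [pow_succ]
    linear_combination ((q : ℂ) ^ n * starRingEnd ℂ (edgeVal q m (n + 1))) * h

/-- At a zero the right boundary term vanishes as well, so `m` is a Rayleigh quotient `T / S ≥ 0`;
and `m = 0` is excluded by `p_n(0) = 1`. -/
lemma pos_of_edgeVal_eq_zero {q : ℝ} (hq : 1 < q) {m : ℂ} {n : ℕ} (h : edgeVal q m n = 0) :
    ∃ x : ℝ, 0 < x ∧ m = x := by
  match n, h with
  | 0, h => simp at h
  | 1, h => simp at h
  | n + 2, h =>
    have hs := edgeVal_sum_by_parts hq m (n + 1)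
    rw [show n + 1 + 1 = n + 2 from rfl, h, map_zero, mul_zero, sub_zero] at hs
    set S : ℝ := ∑ j ∈ Finset.range (n + 1), q ^ j * ‖edgeVal q m (j + 1)‖ ^ 2 with hS
    set T : ℝ := ∑ j ∈ Finset.range (n + 1), q ^ (j + 1) *
        ‖edgeVal q m (j + 2) - edgeVal q m (j + 1)‖ ^ 2 with hT
    have hST : m * (S : ℂ) = (T : ℂ) := by rw [hS, hT]; push_cast; exact hs
    have hSpos : 0 < S := by
      rw [hS, Finset.sum_range_succ']
      have : 0 ≤ ∑ j ∈ Finset.range n, q ^ (j + 1) * ‖edgeVal q m (j + 1 + 1)‖ ^ 2 :=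
        Finset.sum_nonneg fun j _ => by positivity
      simp only [zero_add, pow_zero, edgeVal_one, norm_one, one_pow, mul_one]
      linarith
    have hT0 : 0 ≤ T := Finset.sum_nonneg fun j _ => by positivity
    have hm : m = ((T / S : ℝ) : ℂ) := by
      push_cast
      rw [eq_div_iff (by exact_mod_cast hSpos.ne'), hST]
    refine ⟨T / S, lt_of_le_of_ne (by positivity) fun h0 => ?_, hm⟩
    rw [← h0] at hm
    rw [hm, Complex.ofReal_zero, edgeVal_at_zero hq] at h
    exact one_ne_zero h

lemma norm_sub_ofReal_le {a c : ℂ} (hn : ‖a‖ = ‖c‖) (hre : c.re ≤ a.re) {x : ℝ} (hx : 0 < x) :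
    ‖a - x‖ ≤ ‖c - x‖ := by
  have h : ‖a‖ ^ 2 = ‖c‖ ^ 2 := by rw [hn]
  rw [← sq_le_sq₀ (norm_nonneg _) (norm_nonneg _)]
  simp only [Complex.sq_norm, Complex.normSq_apply, Complex.sub_re, Complex.sub_im,
    Complex.ofReal_re, Complex.ofReal_im] at *
  nlinarith

/-- All zeros of `edgePoly q n` are positive, so on circles about `0` its modulus decreases with
the real part. -/
lemma norm_edgeVal_mono {q : ℝ} (hq : 1 < q) {a c : ℂ} (hn : ‖a‖ = ‖c‖) (hre : c.re ≤ a.re)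
    (n : ℕ) : ‖edgeVal q a n‖ ≤ ‖edgeVal q c n‖ := by
  have hsp := IsAlgClosed.splits (edgePoly q n)
  have key : ∀ x, ‖edgeVal q x n‖ = ‖(edgePoly q n).leadingCoeff‖ *
      ((edgePoly q n).roots.map fun r => ‖x - r‖).prod := by
    intro x
    rw [edgeVal, hsp.eval_eq_prod_roots, norm_mul]
    congr 1
    have := Multiset.prod_hom ((edgePoly q n).roots.map fun r => x - r) (normHom : ℂ →*₀ ℝ)
    rw [Multiset.map_map] at this
    exact this.symm
  rw [key, key]
  refine mul_le_mul_of_nonneg_left ?_ (norm_nonneg _)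
  refine Multiset.prod_map_le_prod_map₀ _ _ (fun _ _ => norm_nonneg _) fun r hr => ?_
  obtain ⟨x, hx, rfl⟩ := pos_of_edgeVal_eq_zero hq (n := n) (Polynomial.isRoot_of_mem_roots hr)
  exact norm_sub_ofReal_le hn hre hx

end GaugeCapacitance

/-! ### Winding numbers, the regions and their boundaries -/

namespace GaugeCapacitance

open Complex

/-- The coupling `b = γ / (e^γ - 1) = -β`. -/
noncomputable def coupling (γ : ℝ) : ℝ := γ / (Real.exp γ - 1)

/-- The spectral parameter `e^{-iθ} lam / b` of the recurrence in the upper half of the chain. -/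
noncomputable def scaled (θ γ : ℝ) (lam : ℂ) : ℂ := exp (-(I * θ)) * lam / coupling γ

lemma one_lt_exp {γ : ℝ} (hγ : 0 < γ) : 1 < Real.exp γ := Real.one_lt_exp_iff.2 hγ

lemma coupling_pos {γ : ℝ} (hγ : 0 < γ) : 0 < coupling γ :=
  div_pos hγ (by linarith [one_lt_exp hγ])

lemma beta_eq (γ : ℝ) : beta γ = -coupling γ := by
  rw [beta, coupling, ← neg_sub (Real.exp γ) 1, div_neg]

lemma eta_eq {γ : ℝ} (hγ : 0 < γ) : eta γ = -(Real.exp γ * coupling γ) := by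
  have h := one_lt_exp hγ
  have h1 : Real.exp γ - 1 ≠ 0 := by linarith
  have h2 : 1 - (Real.exp γ)⁻¹ ≠ 0 := by
    have := inv_lt_one_of_one_lt₀ h; linarith
  rw [eta, coupling, Real.exp_neg]
  field_simp

lemma alpha_eq {γ : ℝ} (hγ : 0 < γ) : alpha γ = (1 + Real.exp γ) * coupling γ := by
  have h : alpha γ = -eta γ - beta γ := by rw [alpha, eta, beta]; ring
  rw [h, eta_eq hγ, beta_eq]; ring

lemma exp_mul_scaled {γ : ℝ} (hγ : 0 < γ) (θ : ℝ) (lam : ℂ) :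
    exp (I * θ) * (coupling γ * scaled θ γ lam) = lam := by
  have h : (coupling γ : ℂ) ≠ 0 := by exact_mod_cast (coupling_pos hγ).ne'
  rw [scaled, mul_div_cancel₀ _ h, ← mul_assoc, ← exp_add, add_neg_cancel, exp_zero, one_mul]

/-- The winding number can be read off: `w⁻¹` contributes `-1`, and each factor `1 - z w`
contributes `1` or `0` as `|z| > 1` or `|z| < 1`. -/
lemma symbolUpper_sub {γ : ℝ} (hγ : 0 < γ) (θ : ℝ) (lam : ℂ) {z₁ z₂ : ℂ}
    (h : CharRoots (Real.exp γ) (scaled θ γ lam) z₁ z₂) (w : Circle) :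
    symbolUpper θ γ w - lam = -(exp (I * θ) * coupling γ * Real.exp γ) * (w : ℂ)⁻¹ *
      ((1 - z₁ * w) * (1 - z₂ * w)) := by
  have hw : (w : ℂ) ≠ 0 := Circle.coe_ne_zero w
  conv_lhs => rw [← exp_mul_scaled hγ θ lam]
  rw [symbolUpper, beta_eq, eta_eq hγ, alpha_eq hγ]
  push_cast
  have h1 := h.sum
  have h2 := h.prod
  push_cast at h1 h2
  field_simp
  linear_combination (coupling γ : ℂ) * ((w : ℂ) ^ 2 * h2 - w * h1)

/-- Two continuous logarithms differ by `2πi` times a continuous integer-valued function, which is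
constant. -/
lemma HasWindingNumber.unique {f : Circle → ℂ} {z : ℂ} {n n' : ℤ} (h : HasWindingNumber f z n)
    (h' : HasWindingNumber f z n') : n = n' := by
  obtain ⟨g, hg, hge, hgn⟩ := h
  obtain ⟨g', hg', hge', hgn'⟩ := h'
  have hp : (2 * Real.pi * I : ℂ) ≠ 0 := two_pi_I_ne_zero
  have hex : ∀ φ, ∃ k : ℤ, g φ = g' φ + k * (2 * Real.pi * I) := fun φ =>
    exp_eq_exp_iff_exists_int.1 ((hge φ).trans (hge' φ).symm)
  choose k hk using hex
  have hcont : Continuous fun φ => ((k φ : ℤ) : ℂ) := by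
    have : (fun φ => ((k φ : ℤ) : ℂ)) = fun φ => (g φ - g' φ) / (2 * Real.pi * I) := by
      funext φ
      rw [hk φ]
      field_simp
      ring
    rw [this]
    exact (hg.sub hg').div_const _
  have hkc : Continuous k := Complex.isClosedEmbedding_intCast.isInducing.continuous_iff.2 hcont
  have hk0 : k (2 * Real.pi) = k 0 := PreconnectedSpace.constant inferInstance hkc
  have h1 := hk (2 * Real.pi)
  have h2 := hk 0
  rw [hk0] at h1
  have : (2 * Real.pi * I : ℂ) * n = 2 * Real.pi * I * n' := by
    rw [← hgn, ← hgn', h1, h2]; ring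
  exact_mod_cast mul_left_cancel₀ hp this

lemma one_sub_mem_slitPlane {z : ℂ} (hz : ‖z‖ < 1) : 1 - z ∈ slitPlane := by
  left
  have := re_le_norm z
  simp only [sub_re, one_re]
  linarith

lemma continuous_log_one_sub (c : ℂ) (hc : ‖c‖ < 1) (s : ℝ) :
    Continuous fun φ : ℝ => log (1 - c * exp (s * φ * I)) := by
  refine Continuous.clog (by fun_prop) fun φ => one_sub_mem_slitPlane ?_
  rw [norm_mul, ← ofReal_mul, norm_exp_ofReal_mul_I, mul_one]
  exact hc

lemma exp_log_one_sub (c : ℂ) (hc : ‖c‖ < 1) (s φ : ℝ) :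
    exp (log (1 - c * exp (s * φ * I))) = 1 - c * exp (s * φ * I) := by
  refine exp_log (slitPlane_ne_zero (one_sub_mem_slitPlane ?_))
  rw [norm_mul, ← ofReal_mul, norm_exp_ofReal_mul_I, mul_one]
  exact hc

lemma hasWindingNumber_neg_one {γ : ℝ} (hγ : 0 < γ) {θ : ℝ} {lam z₁ z₂ : ℂ}
    (h : CharRoots (Real.exp γ) (scaled θ γ lam) z₁ z₂) (hz : ‖z₂‖ < 1) :
    HasWindingNumber (symbolUpper θ γ) lam (-1) := by
  have hz1 : ‖z₁‖ < 1 := h.le.trans_lt hz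
  have hne : -(exp (I * θ) * coupling γ * Real.exp γ) ≠ 0 := by
    have h1 : (coupling γ : ℂ) ≠ 0 := by exact_mod_cast (coupling_pos hγ).ne'
    have h2 : (Real.exp γ : ℂ) ≠ 0 := by exact_mod_cast (Real.exp_pos γ).ne'
    exact neg_ne_zero.2 (mul_ne_zero (mul_ne_zero (exp_ne_zero _) h1) h2)
  refine ⟨fun φ => log (-(exp (I * θ) * coupling γ * Real.exp γ)) + (-(φ * I)) +
    (log (1 - z₁ * exp ((1 : ℝ) * φ * I)) + log (1 - z₂ * exp ((1 : ℝ) * φ * I))), ?_, ?_, ?_⟩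
  · have := continuous_log_one_sub z₁ hz1 1
    have := continuous_log_one_sub z₂ hz 1
    fun_prop
  · intro φ
    rw [symbolUpper_sub hγ θ lam h, exp_add, exp_add, exp_add, exp_log hne,
      exp_log_one_sub _ hz1, exp_log_one_sub _ hz, Circle.coe_exp, exp_neg]
    simp
  · simp

lemma hasWindingNumber_zero {γ : ℝ} (hγ : 0 < γ) {θ : ℝ} {lam z₁ z₂ : ℂ}
    (h : CharRoots (Real.exp γ) (scaled θ γ lam) z₁ z₂) (hz : 1 < ‖z₂‖) :
    HasWindingNumber (symbolUpper θ γ) lam 0 := by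
  have hz1 : ‖z₁‖ < 1 := h.norm_fst_lt_one (one_lt_exp hγ)
  have hz2 : z₂ ≠ 0 := norm_pos_iff.1 h.pos_snd
  have hzi : ‖z₂⁻¹‖ < 1 := by rw [norm_inv]; exact inv_lt_one_of_one_lt₀ hz
  have hne : exp (I * θ) * coupling γ * Real.exp γ * z₂ ≠ 0 := by
    have h1 : (coupling γ : ℂ) ≠ 0 := by exact_mod_cast (coupling_pos hγ).ne'
    have h2 : (Real.exp γ : ℂ) ≠ 0 := by exact_mod_cast (Real.exp_pos γ).ne'
    exact mul_ne_zero (mul_ne_zero (mul_ne_zero (exp_ne_zero _) h1) h2) hz2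
  -- Since `1 - z₂ w = -z₂ w (1 - z₂⁻¹ w⁻¹)`, the factor `w` cancels `w⁻¹` and the principal
  -- logarithm applies to what remains.
  refine ⟨fun φ => log (exp (I * θ) * coupling γ * Real.exp γ * z₂) +
    (log (1 - z₁ * exp ((1 : ℝ) * φ * I)) + log (1 - z₂⁻¹ * exp ((-1 : ℝ) * φ * I))), ?_, ?_, ?_⟩
  · have := continuous_log_one_sub z₁ hz1 1
    have := continuous_log_one_sub z₂⁻¹ hzi (-1)
    fun_prop
  · intro φ
    rw [symbolUpper_sub hγ θ lam h, exp_add, exp_add, exp_log hne,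
      exp_log_one_sub _ hz1, exp_log_one_sub _ hzi, Circle.coe_exp]
    have he : exp ((-1 : ℝ) * φ * I) = (exp (φ * I))⁻¹ := by rw [← exp_neg]; simp
    rw [he]
    have : exp (φ * I) ≠ 0 := exp_ne_zero _
    simp only [ofReal_one, one_mul]
    field_simp
    ring
  · simp [exp_neg]

lemma mem_regionUpper_iff {γ : ℝ} (hγ : 0 < γ) {θ : ℝ} {lam z₁ z₂ : ℂ}
    (h : CharRoots (Real.exp γ) (scaled θ γ lam) z₁ z₂) :
    lam ∈ regionUpper θ γ ↔ ‖z₂‖ < 1 := by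
  constructor
  · rintro ⟨n, hn, hn0⟩
    by_contra! hz
    rcases hz.eq_or_lt with hz | hz
    -- If `|z₂| = 1`, the loop passes through `lam` at `w = z₂⁻¹`, where no logarithm exists.
    · obtain ⟨g, -, hg, -⟩ := hn
      have hz2 : z₂ ≠ 0 := norm_pos_iff.1 h.pos_snd
      have hφ : exp (arg z₂⁻¹ * I) = z₂⁻¹ := by
        have := norm_mul_exp_arg_mul_I z₂⁻¹
        rwa [norm_inv, ← hz, inv_one, ofReal_one, one_mul] at this
      have h1 := hg (arg z₂⁻¹)
      rw [symbolUpper_sub hγ θ lam h, Circle.coe_exp, hφ] at h1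
      simp [hz2] at h1
    · have := hn.unique (hasWindingNumber_zero hγ h hz)
      omega
  · intro hz
    exact ⟨-1, hasWindingNumber_neg_one hγ h hz, by norm_num⟩

/-- The substitution `w ↦ w⁻¹` turns one symbol into the other with `-θ`, and reverses the loop. -/
lemma HasWindingNumber.lower {θ γ : ℝ} {z : ℂ} {n : ℤ}
    (h : HasWindingNumber (symbolLower θ γ) z n) :
    HasWindingNumber (symbolUpper (-θ) γ) z (-n) := by
  obtain ⟨g, hg, hge, hgn⟩ := h
  refine ⟨fun φ => g (2 * Real.pi - φ), by fun_prop, fun φ => ?_, ?_⟩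
  · rw [hge, Circle.periodic_exp.sub_eq', Circle.exp_neg]
    simp only [symbolLower, symbolUpper, Circle.coe_inv, inv_inv, ofReal_neg, mul_neg]
  · simp only [sub_self, sub_zero]
    push_cast
    linear_combination -hgn

lemma HasWindingNumber.upper {θ γ : ℝ} {z : ℂ} {n : ℤ}
    (h : HasWindingNumber (symbolUpper (-θ) γ) z n) :
    HasWindingNumber (symbolLower θ γ) z (-n) := by
  obtain ⟨g, hg, hge, hgn⟩ := h
  refine ⟨fun φ => g (2 * Real.pi - φ), by fun_prop, fun φ => ?_, ?_⟩
  · rw [hge, Circle.periodic_exp.sub_eq', Circle.exp_neg]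
    simp only [symbolLower, symbolUpper, Circle.coe_inv, inv_inv, ofReal_neg, mul_neg]
  · simp only [sub_self, sub_zero]
    push_cast
    linear_combination -hgn

lemma regionLower_eq (θ γ : ℝ) : regionLower θ γ = regionUpper (-θ) γ := by
  ext z
  constructor
  · rintro ⟨n, hn, h0⟩
    exact ⟨-n, hn.lower, h0⟩
  · rintro ⟨n, hn, h0⟩
    exact ⟨-n, hn.upper, by simpa using h0⟩

/-- The point whose characteristic roots are `z` and `(q z)⁻¹`. -/
noncomputable def spectralPoint (θ γ : ℝ) (z : ℂ) : ℂ :=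
  exp (I * θ) * (coupling γ * (1 + Real.exp γ - Real.exp γ * z - z⁻¹))

lemma scaled_spectralPoint {γ : ℝ} (hγ : 0 < γ) (θ : ℝ) (z : ℂ) :
    scaled θ γ (spectralPoint θ γ z) = 1 + Real.exp γ - Real.exp γ * z - z⁻¹ := by
  have h : (coupling γ : ℂ) ≠ 0 := by exact_mod_cast (coupling_pos hγ).ne'
  have h2 : exp (I * θ) ≠ 0 := exp_ne_zero _
  rw [scaled, spectralPoint, exp_neg]
  field_simp

lemma charRoots_spectralPoint {γ : ℝ} (hγ : 0 < γ) (θ : ℝ) {z : ℂ}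
    (hz : 1 ≤ Real.exp γ * ‖z‖ ^ 2) :
    CharRoots (Real.exp γ) (scaled θ γ (spectralPoint θ γ z)) ((Real.exp γ * z)⁻¹) z := by
  have hz0 : z ≠ 0 := by rintro rfl; norm_num at hz
  have h2 : (Real.exp γ : ℂ) ≠ 0 := by exact_mod_cast (Real.exp_pos γ).ne'
  refine ⟨?_, ?_, ?_⟩
  · rw [scaled_spectralPoint hγ]; field_simp; ring
  · field_simp
  · rw [norm_inv, norm_mul, norm_real, Real.norm_of_nonneg (Real.exp_pos γ).le]
    have := norm_pos_iff.2 hz0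
    have := Real.exp_pos γ
    rw [inv_le_comm₀ (by positivity) (by positivity), inv_le_iff_one_le_mul₀ (by positivity)]
    linarith

lemma spectralPoint_mem_frontier {γ : ℝ} (hγ : 0 < γ) (θ : ℝ) {z : ℂ} (hz : ‖z‖ = 1) :
    spectralPoint θ γ z ∈ frontier (regionUpper θ γ) := by
  have hq := one_lt_exp hγ
  have hz0 : z ≠ 0 := by rintro rfl; norm_num at hz
  refine ⟨?_, fun hi => ?_⟩
  -- The point is approached radially: for `t < 1` near `1`, `t z` is still the larger root because
  -- `q t² > 1`, and it lies inside the disc.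
  · have hc : ContinuousAt (fun t : ℝ => spectralPoint θ γ (t * z)) 1 := by
      unfold spectralPoint
      have : ((1 : ℝ) : ℂ) * z ≠ 0 := by simpa using hz0
      fun_prop (disch := assumption)
    have ht : Filter.Tendsto (fun t : ℝ => spectralPoint θ γ (t * z)) (nhdsWithin 1 (Set.Iio 1))
        (nhds (spectralPoint θ γ z)) := by
      have := hc.tendsto.mono_left (nhdsWithin_le_nhds (s := Set.Iio 1))
      simpa using this
    refine mem_closure_of_tendsto ht ?_
    have hev : ∀ᶠ t : ℝ in nhds 1, 1 < Real.exp γ * t ^ 2 ∧ 0 < t := by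
      refine (Filter.Tendsto.eventually_const_lt (by simpa using hq)
        (Continuous.tendsto (by fun_prop) (1 : ℝ))).and (lt_mem_nhds one_pos)
    filter_upwards [hev.filter_mono nhdsWithin_le_nhds, self_mem_nhdsWithin] with t h1 h2
    have hn : ‖(t : ℂ) * z‖ = t := by
      rw [norm_mul, hz, mul_one, norm_real, Real.norm_of_nonneg h1.2.le]
    rw [mem_regionUpper_iff hγ (charRoots_spectralPoint hγ θ (by rw [hn]; exact h1.1.le)), hn]
    exact h2
  · have := interior_subset hi
    rw [mem_regionUpper_iff hγ (charRoots_spectralPoint hγ θ (by rw [hz]; simpa using hq.le)),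
      hz] at this
    exact lt_irrefl _ this

/-- Away from the boundary of the region the dominant root stays away from the unit circle. -/
lemma abs_norm_sub_one_ge {γ σ : ℝ} (hγ : 0 < γ) {θ : ℝ} {lam z₁ z₂ : ℂ}
    (h : CharRoots (Real.exp γ) (scaled θ γ lam) z₁ z₂)
    (hl : lam ∉ Metric.thickening σ (frontier (regionUpper θ γ))) :
    σ / (2 * Real.exp γ * coupling γ) ≤ |‖z₂‖ - 1| := by
  have hq := one_lt_exp hγ
  have hb := coupling_pos hγ
  have hz := h.pos_snd
  have hz0 : z₂ ≠ 0 := norm_pos_iff.1 hz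
  have hnc : ((‖z₂‖ : ℝ) : ℂ) ≠ 0 := by exact_mod_cast hz.ne'
  -- `lam` is compared with the boundary point of the radial projection of `z₂`; the difference
  -- contains the factor `|z₂| - 1`.
  set u : ℂ := z₂ / ‖z₂‖ with hu
  have hun : ‖u‖ = 1 := by
    rw [hu, norm_div, norm_real, norm_norm, div_self hz.ne']
  have hd : σ ≤ dist lam (spectralPoint θ γ u) := by
    by_contra! hlt
    exact hl (Metric.mem_thickening_iff.2 ⟨_, spectralPoint_mem_frontier hγ θ hun, hlt⟩)
  have he : lam - spectralPoint θ γ u = exp (I * θ) * (coupling γ *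
      (((‖z₂‖ - 1 : ℝ) : ℂ) * (z₂⁻¹ - Real.exp γ * u))) := by
    conv_lhs => rw [← exp_mul_scaled hγ θ lam, h.eq_param_snd]
    rw [spectralPoint, hu]
    push_cast
    field_simp
    ring
  have h1 : ‖z₂⁻¹ - Real.exp γ * u‖ ≤ 2 * Real.exp γ := by
    refine (norm_sub_le _ _).trans ?_
    rw [norm_inv, norm_mul, hun, norm_real, Real.norm_of_nonneg (Real.exp_pos γ).le]
    have : ‖z₂‖⁻¹ ≤ Real.exp γ := by
      rw [inv_le_iff_one_le_mul₀ hz]; exact (h.one_lt_mul hq).le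
    linarith
  rw [dist_eq_norm, he, norm_mul, norm_mul, norm_mul, mul_comm I, norm_exp_ofReal_mul_I, norm_real,
    norm_real, Real.norm_of_nonneg hb.le, Real.norm_eq_abs, one_mul] at hd
  rw [div_le_iff₀ (by positivity)]
  calc σ ≤ coupling γ * (|‖z₂‖ - 1| * ‖z₂⁻¹ - Real.exp γ * u‖) := hd
    _ ≤ coupling γ * (|‖z₂‖ - 1| * (2 * Real.exp γ)) := by gcongr
    _ = _ := by ring

lemma zero_mem_boundaryLayer {γ σ : ℝ} (hγ : 0 < γ) (hσ : 0 < σ) (θ : ℝ) :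
    (0 : ℂ) ∈ boundaryLayer θ γ σ := by
  refine Metric.self_subset_thickening hσ _ (Or.inl ?_)
  have := spectralPoint_mem_frontier hγ θ (z := 1) (by simp)
  simpa [spectralPoint] using this

lemma notMem_thickening_of_notMem_boundaryLayer {θ γ σ : ℝ} {lam : ℂ}
    (h : lam ∉ boundaryLayer θ γ σ) :
    lam ∉ Metric.thickening σ (frontier (regionUpper θ γ)) ∧
      lam ∉ Metric.thickening σ (frontier (regionUpper (-θ) γ)) := by
  rw [boundaryLayer, Metric.thickening_union, regionLower_eq] at h
  exact ⟨fun h' => h (Or.inl h'), fun h' => h (Or.inr h')⟩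

end GaugeCapacitance

/-! ### Eigenvectors as two edge solutions glued at the interface -/

namespace GaugeCapacitance

open Complex

lemma entry_add_one {N : ℕ} (v : Fin (2 * N) → ℂ) (i : Fin (2 * N)) :
    entry v ((i : ℕ) + 1) = v i := by
  have h := i.isLt
  rw [entry, dif_pos (by omega)]
  rfl

@[simp] lemma entry_zero {N : ℕ} (v : Fin (2 * N) → ℂ) : entry v 0 = 0 := by simp [entry]

lemma entry_of_lt {N : ℕ} (v : Fin (2 * N) → ℂ) {j : ℕ} (h : 2 * N < j) : entry v j = 0 := by
  rw [entry, dif_neg (by omega)]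

lemma sum_ite_val_eq {N : ℕ} (v : Fin (2 * N) → ℂ) (c : ℂ) (k : ℕ) :
    ∑ j : Fin (2 * N), (if (j : ℕ) = k then c * v j else 0) = c * entry v (k + 1) := by
  by_cases hk : k < 2 * N
  · have : ∀ j : Fin (2 * N), (j : ℕ) = k ↔ j = ⟨k, hk⟩ := fun j => by rw [Fin.ext_iff]
    simp only [this, Finset.sum_ite_eq', Finset.mem_univ, if_true]
    rw [← entry_add_one v ⟨k, hk⟩]
  · rw [entry_of_lt v (by omega), mul_zero]
    refine Finset.sum_eq_zero fun j _ => if_neg ?_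
    have := j.isLt
    omega

lemma sum_ite_val_succ_eq {N : ℕ} (v : Fin (2 * N) → ℂ) (c : ℂ) (k : ℕ) (hk : k ≤ 2 * N) :
    ∑ j : Fin (2 * N), (if k = (j : ℕ) + 1 then c * v j else 0) = c * entry v k := by
  rcases k with _ | k
  · simp
  · simpa [eq_comm] using sum_ite_val_eq v c k

lemma capMatrix_mulVec {N : ℕ} (γ : ℝ) (v : Fin (2 * N) → ℂ) (i : Fin (2 * N)) :
    ((capMatrix N γ).map ofReal).mulVec v i =
      (if (i : ℕ) = 0 ∨ (i : ℕ) + 1 = 2 * N then alpha γ + beta γ else alpha γ : ℝ) *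
          entry v ((i : ℕ) + 1) +
        (if (i : ℕ) < N then eta γ else beta γ : ℝ) * entry v ((i : ℕ) + 2) +
        (if (i : ℕ) < N then beta γ else eta γ : ℝ) * entry v i := by
  have hi := i.isLt
  rw [← sum_ite_val_eq v _ (i : ℕ), ← sum_ite_val_eq v _ ((i : ℕ) + 1),
    ← sum_ite_val_succ_eq v _ (i : ℕ) hi.le, ← Finset.sum_add_distrib, ← Finset.sum_add_distrib,
    Matrix.mulVec, dotProduct]
  refine Finset.sum_congr rfl fun j _ => ?_
  simp only [capMatrix, Matrix.map_apply, Matrix.of_apply]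
  by_cases h1 : i = j
  · subst h1; simp
  · have h1' : ¬ (j : ℕ) = i := fun h => h1 (Fin.ext h.symm)
    rw [if_neg h1, if_neg h1', zero_add]
    by_cases h2 : (j : ℕ) = i + 1
    · rw [if_pos h2, if_pos h2, if_neg (by omega : ¬ (i : ℕ) = j + 1), add_zero]
    · rw [if_neg h2, if_neg h2, zero_add]
      by_cases h3 : (i : ℕ) = j + 1
      · rw [if_pos h3, if_pos h3]
      · rw [if_neg h3, if_neg h3]; simp

lemma genCapMatrix_mulVec {N : ℕ} (θ γ : ℝ) (v : Fin (2 * N) → ℂ) (i : Fin (2 * N)) :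
    (genCapMatrix N θ γ).mulVec v i =
      (if (i : ℕ) < N then exp (I * θ) else exp (-(I * θ))) *
        ((capMatrix N γ).map ofReal).mulVec v i := by
  rw [genCapMatrix, gainLossMatrix, ← Matrix.mulVec_mulVec, Matrix.mulVec_diagonal]

lemma capMatrix_rev {N : ℕ} (γ : ℝ) (i j : Fin (2 * N)) :
    capMatrix N γ i.rev j.rev = capMatrix N γ i j := by
  have hi := i.isLt
  have hj := j.isLt
  simp only [capMatrix, Matrix.of_apply, Fin.rev_inj, Fin.val_rev]
  grind

/-- Reversal preserves `C^γ` and swaps gain with loss, so every statement about the left edge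
transfers to the right edge with `-θ`. -/
lemma genCapMatrix_rev {N : ℕ} (θ γ : ℝ) (v : Fin (2 * N) → ℂ) (i : Fin (2 * N)) :
    (genCapMatrix N (-θ) γ).mulVec (v ∘ Fin.rev) i = (genCapMatrix N θ γ).mulVec v i.rev := by
  rw [genCapMatrix_mulVec, genCapMatrix_mulVec]
  have hi := i.isLt
  congr 1
  · rw [Fin.val_rev]
    by_cases h : (i : ℕ) < N
    · rw [if_pos h, if_neg (by omega)]; simp
    · rw [if_neg h, if_pos (by omega)]; simp
  · simp only [Matrix.mulVec, dotProduct]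
    rw [← Equiv.sum_comp Fin.revPerm]
    refine Finset.sum_congr rfl fun j _ => ?_
    simp only [Matrix.map_apply, Fin.revPerm_apply, Function.comp_apply, Fin.rev_rev]
    rw [← capMatrix_rev γ i.rev j, Fin.rev_rev]

lemma mulVec_rev {N : ℕ} {θ γ : ℝ} {lam : ℂ} {v : Fin (2 * N) → ℂ}
    (h : (genCapMatrix N θ γ).mulVec v = lam • v) :
    (genCapMatrix N (-θ) γ).mulVec (v ∘ Fin.rev) = lam • (v ∘ Fin.rev) := by
  funext i
  rw [genCapMatrix_rev, h]
  rfl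

lemma entry_rev {N : ℕ} (v : Fin (2 * N) → ℂ) (j : ℕ) (hj : 1 ≤ j) :
    entry (v ∘ Fin.rev) j = entry v (2 * N + 1 - j) := by
  by_cases h : j ≤ 2 * N
  · rw [entry, entry, dif_pos ⟨hj, h⟩, dif_pos (by omega), Function.comp_apply]
    congr 1
    ext
    simp only [Fin.val_rev]
    omega
  · rw [entry, entry, dif_neg (by omega), dif_neg (by omega)]

lemma IsEigenpair.rev {N : ℕ} {θ γ : ℝ} {lam : ℂ} {v : Fin (2 * N) → ℂ}
    (h : IsEigenpair N θ γ lam v) : IsEigenpair N (-θ) γ lam (v ∘ Fin.rev) := by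
  refine ⟨fun h0 => h.1 ?_, mulVec_rev h.2⟩
  funext i
  have := congrFun h0 i.rev
  simpa using this

/-- The upper half of an eigenvector solves the recurrence started at the left edge. -/
lemma entry_eq_edgeVal {γ : ℝ} (hγ : 0 < γ) {N : ℕ} {θ : ℝ} {lam : ℂ} {v : Fin (2 * N) → ℂ}
    (h : (genCapMatrix N θ γ).mulVec v = lam • v) {j : ℕ} (hj : 1 ≤ j) (hjN : j ≤ N + 1) :
    entry v j = edgeVal (Real.exp γ) (scaled θ γ lam) j * entry v 1 := by
  have hq := one_lt_exp hγ
  have hb : (coupling γ : ℂ) ≠ 0 := by exact_mod_cast (coupling_pos hγ).ne'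
  have hq0 : (Real.exp γ : ℂ) ≠ 0 := by exact_mod_cast (Real.exp_pos γ).ne'
  set m := scaled θ γ lam with hm
  -- The corner entry `α + β = q b` acts like a fictitious value `v_0 = v_1`, matching `p_0 = p_1`,
  -- whereas `entry v 0` is `0`. Row `i = N - 1` still has upper coefficients, so the formula
  -- reaches site `N + 1`.
  have row : ∀ i : ℕ, i < N → (if i = 0 then Real.exp γ * coupling γ else
      (1 + Real.exp γ) * coupling γ : ℝ) * entry v (i + 1) -
      Real.exp γ * coupling γ * entry v (i + 2) - coupling γ * entry v i =
      coupling γ * m * entry v (i + 1) := by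
    intro i hi
    have h1 := congrFun h ⟨i, by omega⟩
    rw [genCapMatrix_mulVec, capMatrix_mulVec, Pi.smul_apply, ← entry_add_one v ⟨i, _⟩,
      smul_eq_mul, ← exp_mul_scaled hγ θ lam, ← hm] at h1
    simp only [hi, if_true, mul_assoc] at h1
    have h2 := mul_left_cancel₀ (exp_ne_zero _) h1
    simp only [show ¬ i + 1 = 2 * N by omega, or_false] at h2
    rw [eta_eq hγ, alpha_eq hγ, beta_eq] at h2
    rw [mul_assoc (coupling γ : ℂ), ← h2]
    split_ifs <;> push_cast <;> ring
  suffices key : ∀ k, k ≤ N → entry v (k + 1) = edgeVal (Real.exp γ) m (k + 1) * entry v 1 by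
    have := key (j - 1) (by omega)
    rwa [Nat.sub_add_cancel hj] at this
  intro k
  induction k using Nat.strong_induction_on with
  | _ k ih =>
    intro hk
    match k, hk, ih with
    | 0, _, _ => simp
    | 1, hk, _ =>
      have h1 := row 0 (by omega)
      have h2 := edgeVal_add_two hq m 0
      simp only [if_true, zero_add, entry_zero, edgeVal_one, edgeVal_zero] at h1 h2
      push_cast at h1
      apply mul_left_cancel₀ (mul_ne_zero hb hq0)
      push_cast at h2 ⊢
      linear_combination -h1 - coupling γ * entry v 1 * h2
    | k + 2, hk, ih =>
      have h1 := row (k + 1) (by omega)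
      have h2 := edgeVal_add_two hq m (k + 1)
      have i1 := ih k (by omega) (by omega)
      have i2 := ih (k + 1) (by omega) (by omega)
      simp only [Nat.succ_ne_zero, if_false, add_assoc, Nat.reduceAdd] at h1 h2 i1 i2 ⊢
      rw [i1, i2] at h1
      apply mul_left_cancel₀ (mul_ne_zero hb hq0)
      push_cast at h1 h2 ⊢
      linear_combination -h1 - coupling γ * entry v 1 * h2

lemma entry_rev_eq_edgeVal {γ : ℝ} (hγ : 0 < γ) {N : ℕ} {θ : ℝ} {lam : ℂ} {v : Fin (2 * N) → ℂ}
    (h : (genCapMatrix N θ γ).mulVec v = lam • v) {j : ℕ} (hj : 1 ≤ j) (hjN : j ≤ N + 1) :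
    entry v (2 * N + 1 - j) =
      edgeVal (Real.exp γ) (scaled (-θ) γ lam) j * entry v (2 * N) := by
  have := entry_eq_edgeVal hγ (mulVec_rev h) hj hjN
  rwa [entry_rev v j hj, entry_rev v 1 le_rfl, Nat.add_sub_cancel] at this

/-- The two halves of an eigenvector agree at the interface. -/
lemma gluing {γ : ℝ} (hγ : 0 < γ) {N : ℕ} (hN : 1 ≤ N) {θ : ℝ} {lam : ℂ} {v : Fin (2 * N) → ℂ}
    (h : (genCapMatrix N θ γ).mulVec v = lam • v) :
    edgeVal (Real.exp γ) (scaled θ γ lam) N * entry v 1 =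
        edgeVal (Real.exp γ) (scaled (-θ) γ lam) (N + 1) * entry v (2 * N) ∧
      edgeVal (Real.exp γ) (scaled θ γ lam) (N + 1) * entry v 1 =
        edgeVal (Real.exp γ) (scaled (-θ) γ lam) N * entry v (2 * N) := by
  rw [← entry_eq_edgeVal hγ h hN (by omega), ← entry_eq_edgeVal hγ h (by omega) le_rfl,
    ← entry_rev_eq_edgeVal hγ h hN (by omega), ← entry_rev_eq_edgeVal hγ h (by omega) le_rfl]
  exact ⟨by congr 1; omega, by congr 1; omega⟩

lemma IsEigenpair.one_le {N : ℕ} {θ γ : ℝ} {lam : ℂ} {v : Fin (2 * N) → ℂ}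
    (h : IsEigenpair N θ γ lam v) : 1 ≤ N := by
  by_contra! h0
  apply h.1
  funext i
  have := i.isLt
  omega

lemma eq_zero_of_entry_eq_zero {N : ℕ} {v : Fin (2 * N) → ℂ}
    (h : ∀ j, 1 ≤ j → j ≤ N → entry v j = 0 ∧ entry v (2 * N + 1 - j) = 0) : v = 0 := by
  funext i
  have hi := i.isLt
  rw [← entry_add_one v i, Pi.zero_apply]
  by_cases hiN : (i : ℕ) < N
  · exact (h _ (by omega) (by omega)).1
  · have := (h (2 * N - i) (by omega) (by omega)).2
    rwa [show 2 * N + 1 - (2 * N - (i : ℕ)) = i + 1 by omega] at this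

/-- If `v_1 = 0`, gluing forces `v_{2N} = 0`, as `p_N` and `p_{N+1}` have no common zero; then both
halves vanish. -/
lemma IsEigenpair.entry_one_ne_zero {γ : ℝ} (hγ : 0 < γ) {N : ℕ} {θ : ℝ} {lam : ℂ}
    {v : Fin (2 * N) → ℂ} (h : IsEigenpair N θ γ lam v) : entry v 1 ≠ 0 := by
  intro h1
  have hg := gluing hγ h.one_le h.2
  have h2 : entry v (2 * N) = 0 := by
    rw [h1, mul_zero, mul_zero] at hg
    rcases edgeVal_pair_ne_zero (one_lt_exp hγ) (scaled (-θ) γ lam) N with h3 | h3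
    · exact (mul_eq_zero.1 hg.2.symm).resolve_left h3
    · exact (mul_eq_zero.1 hg.1.symm).resolve_left h3
  refine h.1 (eq_zero_of_entry_eq_zero fun j hj hjN => ⟨?_, ?_⟩)
  · rw [entry_eq_edgeVal hγ h.2 hj (by omega), h1, mul_zero]
  · rw [entry_rev_eq_edgeVal hγ h.2 hj (by omega), h2, mul_zero]

lemma IsEigenpair.entry_last_ne_zero {γ : ℝ} (hγ : 0 < γ) {N : ℕ} {θ : ℝ} {lam : ℂ}
    {v : Fin (2 * N) → ℂ} (h : IsEigenpair N θ γ lam v) : entry v (2 * N) ≠ 0 := by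
  have := h.rev.entry_one_ne_zero hγ
  rwa [entry_rev v 1 le_rfl, Nat.add_sub_cancel] at this

lemma IsEigenpair.characteristic {γ : ℝ} (hγ : 0 < γ) {N : ℕ} {θ : ℝ} {lam : ℂ}
    {v : Fin (2 * N) → ℂ} (h : IsEigenpair N θ γ lam v) :
    edgeVal (Real.exp γ) (scaled θ γ lam) (N + 1) *
        edgeVal (Real.exp γ) (scaled (-θ) γ lam) (N + 1) =
      edgeVal (Real.exp γ) (scaled θ γ lam) N * edgeVal (Real.exp γ) (scaled (-θ) γ lam) N := by
  obtain ⟨h1, h2⟩ := gluing hγ h.one_le h.2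
  apply mul_right_cancel₀ (h.entry_last_ne_zero hγ)
  apply mul_right_cancel₀ (h.entry_one_ne_zero hγ)
  linear_combination edgeVal (Real.exp γ) (scaled (-θ) γ lam) (N + 1) * entry v (2 * N) * h2 -
    edgeVal (Real.exp γ) (scaled (-θ) γ lam) N * entry v (2 * N) * h1

lemma mulVec_const {γ : ℝ} (hγ : 0 < γ) (N : ℕ) (θ : ℝ) (c : ℂ) :
    (genCapMatrix N θ γ).mulVec (fun _ => c) = 0 := by
  funext i
  have hi := i.isLt
  have e : ∀ j, 1 ≤ j → j ≤ 2 * N → entry (N := N) (fun _ => c) j = c := fun j h1 h2 => by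
    rw [entry, dif_pos ⟨h1, h2⟩]
  rw [genCapMatrix_mulVec, capMatrix_mulVec, Pi.zero_apply, e _ (by omega) (by omega),
    eta_eq hγ, alpha_eq hγ, beta_eq]
  by_cases h0 : (i : ℕ) = 0
  · rw [h0, e 2 (by norm_num) (by omega), entry_zero]
    simp [show 0 < N by omega]
    ring_nf
  · rw [e i (by omega) (by omega)]
    by_cases h1 : (i : ℕ) + 1 = 2 * N
    · rw [entry_of_lt _ (by omega)]
      simp [h1, show ¬ (i : ℕ) < N by omega]
      ring_nf
    · rw [e _ (by omega) (by omega)]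
      simp only [h0, h1, or_self, if_false]
      split_ifs <;> push_cast <;> ring

lemma mulVec_eq_zero_iff {γ : ℝ} (hγ : 0 < γ) (N : ℕ) (θ : ℝ) (v : Fin (2 * N) → ℂ) :
    (genCapMatrix N θ γ).mulVec v = 0 ↔ ∃ c : ℂ, v = fun _ => c := by
  refine ⟨fun h => ⟨entry v 1, ?_⟩, ?_⟩
  · have h' : (genCapMatrix N θ γ).mulVec v = (0 : ℂ) • v := by rw [h, zero_smul]
    have hv : ∀ j, 1 ≤ j → j ≤ N + 1 → entry v j = entry v 1 := fun j h1 h2 => by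
      rw [entry_eq_edgeVal hγ h' h1 h2]
      simp [scaled, edgeVal_at_zero (one_lt_exp hγ)]
    have hw : ∀ j, 1 ≤ j → j ≤ N + 1 → entry v (2 * N + 1 - j) = entry v (2 * N) :=
      fun j h1 h2 => by
        rw [entry_rev_eq_edgeVal hγ h' h1 h2]
        simp [scaled, edgeVal_at_zero (one_lt_exp hγ)]
    funext i
    have hi := i.isLt
    rw [← entry_add_one v i]
    by_cases hiN : (i : ℕ) < N
    · exact hv _ (by omega) (by omega)
    · have h1 := hw (2 * N - i) (by omega) (by omega)
      -- Site `N + 1` lies in the range of both halves, so the two constants agree.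
      have h2 := hw N (by omega) (by omega)
      rw [show 2 * N + 1 - (2 * N - (i : ℕ)) = i + 1 by omega] at h1
      rw [show 2 * N + 1 - N = N + 1 by omega, hv (N + 1) (by omega) le_rfl] at h2
      rw [h1, ← h2]
  · rintro ⟨c, rfl⟩
    exact mulVec_const hγ N θ c

end GaugeCapacitance

/-! ### Location of eigenvalues, dominating edge and decay -/

namespace GaugeCapacitance

open Complex

/-- A lower bound for the distance of the dominant root to the unit circle off the layer. -/
noncomputable def rootGap (γ σ : ℝ) : ℝ := min (σ / (2 * Real.exp γ * coupling γ)) (1 / 2)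

lemma rootGap_pos {γ σ : ℝ} (hγ : 0 < γ) (hσ : 0 < σ) : 0 < rootGap γ σ := by
  have := coupling_pos hγ
  exact lt_min (by positivity) (by norm_num)

lemma rootGap_le (γ σ : ℝ) : rootGap γ σ ≤ 1 / 2 := min_le_right _ _

lemma norm_root_le_of_mem {γ σ : ℝ} (hγ : 0 < γ) {θ : ℝ} {lam z₁ z₂ : ℂ}
    (h : CharRoots (Real.exp γ) (scaled θ γ lam) z₁ z₂)
    (hl : lam ∉ Metric.thickening σ (frontier (regionUpper θ γ)))
    (hm : lam ∈ regionUpper θ γ) : ‖z₂‖ ≤ 1 - rootGap γ σ := by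
  have h1 := abs_norm_sub_one_ge hγ h hl
  rw [mem_regionUpper_iff hγ h] at hm
  rw [abs_of_neg (by linarith)] at h1
  have h2 : rootGap γ σ ≤ _ := min_le_left _ _
  linarith

lemma le_norm_root_of_notMem {γ σ : ℝ} (hγ : 0 < γ) {θ : ℝ} {lam z₁ z₂ : ℂ}
    (h : CharRoots (Real.exp γ) (scaled θ γ lam) z₁ z₂)
    (hl : lam ∉ Metric.thickening σ (frontier (regionUpper θ γ)))
    (hm : lam ∉ regionUpper θ γ) : 1 + rootGap γ σ ≤ ‖z₂‖ := by
  have h1 := abs_norm_sub_one_ge hγ h hl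
  rw [mem_regionUpper_iff hγ h, not_lt] at hm
  rw [abs_of_nonneg (by linarith)] at h1
  have h2 : rootGap γ σ ≤ _ := min_le_left _ _
  linarith

lemma exists_mem_region {γ σ : ℝ} (hγ : 0 < γ) (hσ : 0 < σ) (θ : ℝ) :
    ∃ N₀ : ℕ, ∀ N ≥ N₀, ∀ (lam : ℂ) (v : Fin (2 * N) → ℂ), IsEigenpair N θ γ lam v →
      lam ∉ boundaryLayer θ γ σ → lam ∈ regionUpper θ γ ∨ lam ∈ regionLower θ γ := by
  have hq := one_lt_exp hγ
  have hδ := rootGap_pos hγ hσ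
  have hq1 : 1 / Real.exp γ < 1 := by rw [div_lt_one (by linarith)]; exact hq
  have hε : 0 < (1 - 1 / Real.exp γ) * rootGap γ σ / 4 := by
    have : 0 < 1 - 1 / Real.exp γ := by linarith
    positivity
  obtain ⟨N₀, hN₀⟩ := exists_pow_lt_of_lt_one hε hq1
  refine ⟨N₀, fun N hN lam v hv hl => ?_⟩
  by_contra! hno
  obtain ⟨hl1, hl2⟩ := notMem_thickening_of_notMem_boundaryLayer hl
  rw [regionLower_eq] at hno
  obtain ⟨z₁, z₂, hz⟩ := exists_charRoots hq (scaled θ γ lam)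
  obtain ⟨y₁, y₂, hy⟩ := exists_charRoots hq (scaled (-θ) γ lam)
  have hs : (1 / Real.exp γ) ^ N < (1 - 1 / Real.exp γ) * rootGap γ σ / 4 :=
    (pow_le_pow_of_le_one (by positivity) hq1.le hN).trans_lt hN₀
  have h1 := hz.norm_edgeVal_lt_succ hq hδ (le_norm_root_of_notMem hγ hz hl1 hno.1) hv.one_le hs
  have h2 := hy.norm_edgeVal_lt_succ hq hδ (le_norm_root_of_notMem hγ hy hl2 hno.2) hv.one_le hs
  have h3 := congrArg norm (hv.characteristic hγ)
  rw [norm_mul, norm_mul] at h3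
  exact absurd h3 (mul_lt_mul'' h1 h2 (norm_nonneg _) (norm_nonneg _)).ne'

/-- For `|z₂| = r` the point `m = 1 + q - q z₂ - z₂⁻¹` has smallest real part at `z₂ = r`, namely
`(1 - r)(q r - 1)/r`; and `r ≥ q^{-1/2}`. -/
lemma CharRoots.le_re {q : ℝ} {m z₁ z₂ : ℂ} (h : CharRoots q m z₁ z₂) (hq : 1 < q) {δ : ℝ}
    (hδ : 0 < δ) (hz : ‖z₂‖ ≤ 1 - δ) : δ * (√q - 1) ≤ m.re := by
  have hr := h.pos_snd
  have h1 : √q ≤ q * ‖z₂‖ := by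
    refine Real.sqrt_le_iff.2 ⟨by positivity, ?_⟩
    have := h.one_le_sq hq
    nlinarith
  have h2 : 1 < √q := by rw [Real.lt_sqrt (by norm_num)]; simpa using hq
  have h3 : z₂.re ≤ ‖z₂‖ := re_le_norm z₂
  have h4 : m.re = 1 + q - (q + (‖z₂‖ ^ 2)⁻¹) * z₂.re := by
    rw [h.eq_param_snd]
    simp only [sub_re, add_re, one_re, ofReal_re, re_ofReal_mul, inv_re, normSq_eq_norm_sq]
    ring
  have h5 : (q + (‖z₂‖ ^ 2)⁻¹) * z₂.re ≤ (q + (‖z₂‖ ^ 2)⁻¹) * ‖z₂‖ :=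
    mul_le_mul_of_nonneg_left h3 (by positivity)
  have h6 : 1 + q - (q + (‖z₂‖ ^ 2)⁻¹) * ‖z₂‖ = (1 - ‖z₂‖) * (q * ‖z₂‖ - 1) * ‖z₂‖⁻¹ := by
    field_simp
    ring
  have h7 : 1 ≤ ‖z₂‖⁻¹ := (one_le_inv₀ hr).2 (by linarith)
  have h8 : δ * (√q - 1) ≤ (1 - ‖z₂‖) * (q * ‖z₂‖ - 1) :=
    mul_le_mul (by linarith) (by linarith) (by linarith) (by linarith)
  have h9 : 0 ≤ δ * (√q - 1) := mul_nonneg hδ.le (by linarith)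
  nlinarith

/-- With `r = |z₂|`, `Im m = -(q - r⁻²) Im z₂`, so a large imaginary part keeps `q r²` away from
`1`, and `|z₁| / |z₂| = 1 / (q r²)`. -/
lemma CharRoots.norm_fst_le_of_le_im {q : ℝ} {m z₁ z₂ : ℂ} (h : CharRoots q m z₁ z₂) (hq : 1 < q)
    {ε : ℝ} (hε : 0 < ε) (him : ε ≤ |m.im|) : ‖z₁‖ ≤ (1 + ε / q)⁻¹ * ‖z₂‖ := by
  have hr := h.pos_snd
  have hq0 : 0 < q := by linarith
  have h1 := h.one_le_sq hq
  have h4 : m.im = -((q - (‖z₂‖ ^ 2)⁻¹) * z₂.im) := by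
    rw [h.eq_param_snd]
    simp only [sub_im, add_im, one_im, ofReal_im, im_ofReal_mul, inv_im, normSq_eq_norm_sq]
    ring
  have h5 : 0 ≤ q - (‖z₂‖ ^ 2)⁻¹ := by
    rw [sub_nonneg, inv_le_iff_one_le_mul₀ (by positivity)]; exact h1
  have h6 : |m.im| ≤ (q - (‖z₂‖ ^ 2)⁻¹) * ‖z₂‖ := by
    rw [h4, abs_neg, abs_mul, abs_of_nonneg h5]
    exact mul_le_mul_of_nonneg_left (abs_im_le_norm z₂) h5
  have h7 : ε * ‖z₂‖ ≤ q * ‖z₂‖ ^ 2 - 1 := by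
    calc ε * ‖z₂‖ ≤ (q - (‖z₂‖ ^ 2)⁻¹) * ‖z₂‖ * ‖z₂‖ := by gcongr; exact him.trans h6
      _ = _ := by field_simp
  have h8 : ε / q ≤ ε * ‖z₂‖ := by
    rw [div_le_iff₀ hq0]; have := (h.one_lt_mul hq).le; nlinarith
  rw [inv_mul_eq_div, le_div_iff₀ (by positivity)]
  have h9 : ‖z₁‖ * (1 + ε / q) ≤ ‖z₁‖ * (q * ‖z₂‖ ^ 2) := by gcongr; linarith
  have h10 := h.norm_prod hq
  calc _ ≤ _ := h9
    _ = q * (‖z₁‖ * ‖z₂‖) * ‖z₂‖ := by ring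
    _ = ‖z₂‖ := by rw [h10, one_mul]

lemma re_le_abs_im_of_rotation {a c : ℂ} {t : ℝ} (h : c = exp (t * I) * a) (ht : Real.cos t ≤ 0)
    (ha : 0 ≤ a.re) : c.re ≤ |a.im| := by
  have h1 : c.re = Real.cos t * a.re - Real.sin t * a.im := by
    rw [h, mul_re, exp_ofReal_mul_I_re, exp_ofReal_mul_I_im]
  have h2 : |Real.sin t * a.im| ≤ |a.im| := by
    rw [abs_mul]; exact mul_le_of_le_one_left (abs_nonneg _) (Real.abs_sin_le_one t)
  have h3 := neg_abs_le (Real.sin t * a.im)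
  nlinarith

lemma scaled_neg_eq (θ γ : ℝ) (lam : ℂ) :
    scaled (-θ) γ lam = exp ((2 * θ : ℝ) * I) * scaled θ γ lam := by
  rw [scaled, scaled, mul_div_assoc, mul_div_assoc, ← mul_assoc, ← exp_add]
  congr 2
  push_cast
  ring

lemma exists_notMem_inter {γ σ : ℝ} (hγ : 0 < γ) (hσ : 0 < σ) {θ : ℝ} (h1 : Real.pi / 4 ≤ θ)
    (h2 : θ ≤ Real.pi / 2) :
    ∃ N₀ : ℕ, ∀ N ≥ N₀, ∀ (lam : ℂ) (v : Fin (2 * N) → ℂ), IsEigenpair N θ γ lam v →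
      lam ∉ (regionUpper θ γ ∩ regionLower θ γ) \ boundaryLayer θ γ σ := by
  have hq := one_lt_exp hγ
  have hq0 := Real.exp_pos γ
  have hδ := rootGap_pos hγ hσ
  set δ := rootGap γ σ with hδd
  set ε := δ * (√(Real.exp γ) - 1) with hεd
  have hε : 0 < ε := by
    have : 1 < √(Real.exp γ) := by rw [Real.lt_sqrt (by norm_num)]; simpa using hq
    exact mul_pos hδ (by linarith)
  have hκ : (1 + ε / Real.exp γ)⁻¹ < 1 := by
    refine inv_lt_one_of_one_lt₀ ?_
    have : 0 < ε / Real.exp γ := by positivity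
    linarith
  obtain ⟨N₀, hN₀⟩ := exists_pow_lt_of_lt_one (by positivity : 0 < δ ^ 2 / 4) hκ
  refine ⟨N₀, fun N hN lam v hv ⟨⟨hu, hd⟩, hl⟩ => ?_⟩
  obtain ⟨hl1, hl2⟩ := notMem_thickening_of_notMem_boundaryLayer hl
  rw [regionLower_eq] at hd
  obtain ⟨z₁, z₂, hz⟩ := exists_charRoots hq (scaled θ γ lam)
  obtain ⟨y₁, y₂, hy⟩ := exists_charRoots hq (scaled (-θ) γ lam)
  have hz2 := norm_root_le_of_mem hγ hz hl1 hu
  have hy2 := norm_root_le_of_mem hγ hy hl2 hd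
  have hzr := hz.le_re hq hδ hz2
  have hyr := hy.le_re hq hδ hy2
  have hcos : Real.cos (2 * θ) ≤ 0 :=
    Real.cos_nonpos_of_pi_div_two_le_of_le (by linarith) (by linarith [Real.pi_pos])
  -- Both parameters have real part at least `ε`, yet differ by a rotation with nonpositive cosine;
  -- the imaginary parts must make up for it.
  have hzi : ε ≤ |(scaled θ γ lam).im| :=
    hyr.trans (re_le_abs_im_of_rotation (scaled_neg_eq θ γ lam) hcos (hε.le.trans hzr))
  have hyi : ε ≤ |(scaled (-θ) γ lam).im| := by
    have := scaled_neg_eq (-θ) γ lam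
    rw [neg_neg] at this
    refine hzr.trans (re_le_abs_im_of_rotation this ?_ (hε.le.trans hyr))
    rwa [mul_neg, Real.cos_neg]
  have hs : (1 + ε / Real.exp γ)⁻¹ ^ N < δ ^ 2 / 4 :=
    (pow_le_pow_of_le_one (by positivity) hκ.le hN).trans_lt hN₀
  have h5 := hz.norm_edgeVal_succ_lt hq hδ hz2 hκ (hz.norm_fst_le_of_le_im hq hε hzi) hs
  have h6 := hy.norm_edgeVal_succ_lt hq hδ hy2 hκ (hy.norm_fst_le_of_le_im hq hε hyi) hs
  have h3 := congrArg norm (hv.characteristic hγ)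
  rw [norm_mul, norm_mul] at h3
  exact absurd h3 (mul_lt_mul'' h5 h6 (norm_nonneg _) (norm_nonneg _)).ne

lemma norm_scaled {γ : ℝ} (hγ : 0 < γ) (θ : ℝ) (lam : ℂ) :
    ‖scaled θ γ lam‖ = ‖lam‖ / coupling γ := by
  have : -(I * (θ : ℂ)) = ((-θ : ℝ) : ℂ) * I := by push_cast; ring
  rw [scaled, norm_div, norm_mul, this, norm_exp_ofReal_mul_I, one_mul, norm_real,
    Real.norm_of_nonneg (coupling_pos hγ).le]

lemma scaled_re (θ γ : ℝ) (lam : ℂ) :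
    (scaled θ γ lam).re = (Real.cos θ * lam.re + Real.sin θ * lam.im) / coupling γ := by
  have : -(I * (θ : ℂ)) = ((-θ : ℝ) : ℂ) * I := by push_cast; ring
  rw [scaled, div_ofReal_re, mul_re, this, exp_ofReal_mul_I_re, exp_ofReal_mul_I_im, Real.cos_neg,
    Real.sin_neg]
  ring

/-- Otherwise `m` and `m' = e^{2iθ} m` would both be positive, contrary to `sin 2θ > 0`. -/
lemma edgeVal_ne_zero_of_edgeVal_eq_zero {γ : ℝ} (hγ : 0 < γ) {θ : ℝ} (h0 : 0 < θ)
    (h1 : θ < Real.pi / 2) {lam : ℂ} {k l : ℕ}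
    (hk : edgeVal (Real.exp γ) (scaled θ γ lam) k = 0) :
    edgeVal (Real.exp γ) (scaled (-θ) γ lam) l ≠ 0 := by
  intro hl
  have hq := one_lt_exp hγ
  obtain ⟨x, hx, ha⟩ := pos_of_edgeVal_eq_zero hq hk
  obtain ⟨y, hy, hc⟩ := pos_of_edgeVal_eq_zero hq hl
  have h2 := scaled_neg_eq θ γ lam
  rw [ha, hc] at h2
  have h3 := congrArg im h2
  rw [im_mul_ofReal, exp_ofReal_mul_I_im, ofReal_im] at h3
  have h4 : 0 < Real.sin (2 * θ) := Real.sin_pos_of_pos_of_lt_pi (by linarith) (by linarith)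
  exact (mul_pos h4 hx).ne h3

/-- For eigenvalues in the closed upper half plane the left edge dominates. -/
lemma IsEigenpair.norm_last_le {γ : ℝ} (hγ : 0 < γ) {N : ℕ} {θ : ℝ} (h0 : 0 < θ)
    (h1 : θ < Real.pi / 2) {lam : ℂ} {v : Fin (2 * N) → ℂ} (h : IsEigenpair N θ γ lam v)
    (him : 0 ≤ lam.im) : ‖entry v (2 * N)‖ ≤ ‖entry v 1‖ := by
  have hq := one_lt_exp hγ
  obtain ⟨g1, g2⟩ := gluing hγ h.one_le h.2
  have hv1 := h.entry_one_ne_zero hγ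
  have hre : (scaled (-θ) γ lam).re ≤ (scaled θ γ lam).re := by
    rw [scaled_re, scaled_re, Real.cos_neg, Real.sin_neg]
    have := coupling_pos hγ
    have := Real.sin_pos_of_pos_of_lt_pi h0 (by linarith)
    gcongr
    linarith
  have hn : ‖scaled θ γ lam‖ = ‖scaled (-θ) γ lam‖ := by rw [norm_scaled hγ, norm_scaled hγ]
  have m1 := norm_edgeVal_mono hq hn hre N
  have m2 := norm_edgeVal_mono hq hn hre (N + 1)
  have d1 : edgeVal (Real.exp γ) (scaled (-θ) γ lam) N ≠ 0 := by
    intro hz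
    rw [hz, zero_mul] at g2
    exact edgeVal_ne_zero_of_edgeVal_eq_zero hγ h0 h1 ((mul_eq_zero.1 g2).resolve_right hv1) hz
  have d2 : edgeVal (Real.exp γ) (scaled (-θ) γ lam) (N + 1) ≠ 0 := by
    intro hz
    rw [hz, zero_mul] at g1
    exact edgeVal_ne_zero_of_edgeVal_eq_zero hγ h0 h1 ((mul_eq_zero.1 g1).resolve_right hv1) hz
  have d3 := mul_pos (norm_pos_iff.2 d1) (norm_pos_iff.2 d2)
  have m3 := mul_le_mul m1 m2 (norm_nonneg _) (norm_nonneg _)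
  have n1 := congrArg norm g1
  have n2 := congrArg norm g2
  simp only [norm_mul] at n1 n2
  by_contra! hlt
  have hsq : ‖entry v 1‖ ^ 2 < ‖entry v (2 * N)‖ ^ 2 := by gcongr
  -- The product of the two gluing equations, in modulus.
  have e : ‖edgeVal (Real.exp γ) (scaled θ γ lam) N‖ *
        ‖edgeVal (Real.exp γ) (scaled θ γ lam) (N + 1)‖ * ‖entry v 1‖ ^ 2 =
      ‖edgeVal (Real.exp γ) (scaled (-θ) γ lam) N‖ *
        ‖edgeVal (Real.exp γ) (scaled (-θ) γ lam) (N + 1)‖ * ‖entry v (2 * N)‖ ^ 2 := by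
    linear_combination ‖edgeVal (Real.exp γ) (scaled θ γ lam) (N + 1)‖ * ‖entry v 1‖ * n1 +
      ‖edgeVal (Real.exp γ) (scaled (-θ) γ lam) (N + 1)‖ * ‖entry v (2 * N)‖ * n2
  have l1 := mul_le_mul_of_nonneg_right m3 (sq_nonneg ‖entry v 1‖)
  have l2 := mul_lt_mul_of_pos_left hsq d3
  linarith

lemma scaled_conj (θ γ : ℝ) (lam : ℂ) :
    scaled (-θ) γ (starRingEnd ℂ lam) = starRingEnd ℂ (scaled θ γ lam) := by
  simp only [scaled, map_div₀, map_mul, conj_ofReal, ← exp_conj, map_neg, conj_I, ofReal_neg]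
  congr 3
  ring

lemma mulVec_conj {N : ℕ} {θ γ : ℝ} {lam : ℂ} {v : Fin (2 * N) → ℂ}
    (h : (genCapMatrix N θ γ).mulVec v = lam • v) :
    (genCapMatrix N (-θ) γ).mulVec (fun i => starRingEnd ℂ (v i)) =
      starRingEnd ℂ lam • fun i => starRingEnd ℂ (v i) := by
  funext i
  have h1 := congrArg (starRingEnd ℂ) (congrFun h i)
  rw [genCapMatrix_mulVec, map_mul] at h1
  rw [genCapMatrix_mulVec]
  simp only [Pi.smul_apply, smul_eq_mul, map_mul] at h1 ⊢
  rw [← h1]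
  congr 1
  · split_ifs <;> simp [← exp_conj]
  · simp only [Matrix.mulVec, dotProduct, map_sum, map_mul, Matrix.map_apply, conj_ofReal]

/-- Conjugating and reversing an eigenvector. -/
lemma IsEigenpair.conj_rev {N : ℕ} {θ γ : ℝ} {lam : ℂ} {v : Fin (2 * N) → ℂ}
    (h : IsEigenpair N θ γ lam v) :
    IsEigenpair N θ γ (starRingEnd ℂ lam) ((fun i => starRingEnd ℂ (v i)) ∘ Fin.rev) := by
  have h1 : IsEigenpair N (-θ) γ (starRingEnd ℂ lam) (fun i => starRingEnd ℂ (v i)) := by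
    refine ⟨fun h0 => h.1 ?_, mulVec_conj h.2⟩
    funext i
    simpa using congrFun h0 i
  simpa using h1.rev

lemma norm_entry_conj {N : ℕ} (v : Fin (2 * N) → ℂ) (j : ℕ) :
    ‖entry (fun i => starRingEnd ℂ (v i)) j‖ = ‖entry v j‖ := by
  unfold entry
  split_ifs
  · exact norm_conj _
  · rfl

lemma IsEigenpair.norm_one_le {γ : ℝ} (hγ : 0 < γ) {N : ℕ} {θ : ℝ} (h0 : 0 < θ)
    (h1 : θ < Real.pi / 2) {lam : ℂ} {v : Fin (2 * N) → ℂ} (h : IsEigenpair N θ γ lam v)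
    (him : lam.im ≤ 0) : ‖entry v 1‖ ≤ ‖entry v (2 * N)‖ := by
  have h2 := h.conj_rev.norm_last_le hγ h0 h1 (by simpa using him)
  have hN := h.one_le
  rw [entry_rev _ 1 le_rfl, entry_rev _ (2 * N) (by omega), norm_entry_conj, norm_entry_conj,
    Nat.add_sub_cancel, Nat.add_sub_cancel_left] at h2
  exact h2

/-- For real `lam` both dominance inequalities apply, and the two spectral parameters are complex
conjugates. -/
lemma IsEigenpair.norm_symm {γ : ℝ} (hγ : 0 < γ) {N : ℕ} {θ : ℝ} (h0 : 0 < θ)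
    (h1 : θ < Real.pi / 2) {lam : ℝ} {v : Fin (2 * N) → ℂ} (h : IsEigenpair N θ γ lam v)
    {j : ℕ} (hj : 1 ≤ j) (hjN : j ≤ N) : ‖entry v j‖ = ‖entry v (2 * N + 1 - j)‖ := by
  have he : ‖entry v 1‖ = ‖entry v (2 * N)‖ :=
    le_antisymm (h.norm_one_le hγ h0 h1 (by simp)) (h.norm_last_le hγ h0 h1 (by simp))
  have hc := scaled_conj θ γ lam
  rw [conj_ofReal] at hc
  rw [entry_eq_edgeVal hγ h.2 hj (by omega), entry_rev_eq_edgeVal hγ h.2 hj (by omega), hc,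
    edgeVal_conj (one_lt_exp hγ), norm_mul, norm_mul, norm_conj, he]

/-- If the characteristic roots lie inside the disc for the left half and outside for the right
half, the eigenvector decays from the left edge along the whole chain. -/
lemma IsEigenpair.norm_entry_le {γ : ℝ} (hγ : 0 < γ) {N : ℕ} {θ : ℝ} {lam : ℂ}
    {v : Fin (2 * N) → ℂ} (h : IsEigenpair N θ γ lam v) {z₁ z₂ y₁ y₂ : ℂ}
    (hz : CharRoots (Real.exp γ) (scaled θ γ lam) z₁ z₂)
    (hy : CharRoots (Real.exp γ) (scaled (-θ) γ lam) y₁ y₂) {δ : ℝ} (hδ : 0 < δ)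
    (hδ2 : δ ≤ 1 / 2) (hz2 : ‖z₂‖ ≤ 1 - δ) (hy2 : 1 + δ ≤ ‖y₂‖) {j : ℕ} (hj : 1 ≤ j)
    (hjN : j ≤ 2 * N) :
    ‖entry v j‖ ≤ 2 * (4 / δ) * (2 * Real.exp γ / (Real.exp γ - 1)) ^ 2 * (1 - δ / 2) ^ j *
      ‖entry v 1‖ := by
  have hq := one_lt_exp hγ
  have hq1 : 0 < Real.exp γ - 1 := by linarith
  set q := Real.exp γ with hqd
  set K := 4 / δ with hK
  set K' := 2 * q / (q - 1) with hK'
  set r := 1 - δ / 2 with hr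
  have hK0 : 0 < K := by positivity
  have hK1 : 1 ≤ K' := by rw [hK', le_div_iff₀ hq1]; linarith
  have hr0 : 0 < r := by rw [hr]; linarith
  have hv := norm_nonneg (entry v 1)
  have hp := hz.norm_edgeVal_le hq hδ hz2
  by_cases hjn : j ≤ N
  · rw [entry_eq_edgeVal hγ h.2 hj (by omega), norm_mul]
    gcongr
    refine (hp j).trans ?_
    gcongr
    have : 1 ≤ K' ^ 2 := one_le_pow₀ hK1
    rw [← hK]
    nlinarith
  · obtain ⟨k, hk⟩ : ∃ k, k = 2 * N + 1 - j := ⟨_, rfl⟩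
    have hjk : j = 2 * N + 1 - k := by omega
    obtain ⟨g1, g2⟩ := gluing hγ h.one_le h.2
    have hst := hy.step_fst hq N
    -- Combining the gluing equations so as to remove the `y₁` mode isolates the growing part of the
    -- right half; this makes `v_{2N}` small compared with `v_1`.
    have hW : entry v (2 * N) * ((1 - y₁) * y₂ ^ N) =
        (edgeVal q (scaled θ γ lam) N - y₁ * edgeVal q (scaled θ γ lam) (N + 1)) *
          entry v 1 := by
      rw [← hst]; linear_combination -g1 + y₁ * g2
    have hy1 : ‖y₁‖ ≤ 1 / q := by
      rw [le_div_iff₀ (by linarith)]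
      have := hy.norm_prod hq
      have := hy.pos_fst
      nlinarith
    have hy1' : ‖y₁‖ ≤ 1 := (hy.norm_fst_lt_one hq).le
    have hpN : ‖edgeVal q (scaled θ γ lam) (N + 1)‖ ≤ K * r ^ N := by
      refine (hp (N + 1)).trans ?_
      refine mul_le_mul_of_nonneg_left (pow_le_pow_of_le_one hr0.le ?_ (by omega)) hK0.le
      rw [hr]; linarith
    have hR : ‖edgeVal q (scaled θ γ lam) N - y₁ * edgeVal q (scaled θ γ lam) (N + 1)‖ ≤
        2 * K * r ^ N := by
      refine (norm_sub_le _ _).trans ?_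
      rw [norm_mul]
      have := mul_le_mul hy1' hpN (norm_nonneg _) zero_le_one
      linarith [hp N]
    have h1y : 2 / K' ≤ ‖1 - y₁‖ := by
      have := norm_sub_norm_le (1 : ℂ) y₁
      rw [norm_one] at this
      have e : 2 / K' = 1 - 1 / q := by rw [hK']; field_simp
      linarith
    have hWn : ‖entry v (2 * N)‖ * ‖y₂‖ ^ N ≤ K' * K * r ^ N * ‖entry v 1‖ := by
      have e := congrArg norm hW
      rw [norm_mul, norm_mul, norm_mul, norm_pow] at e
      have l1 : 2 / K' * (‖entry v (2 * N)‖ * ‖y₂‖ ^ N) ≤ 2 * K * r ^ N * ‖entry v 1‖ := by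
        calc _ ≤ ‖1 - y₁‖ * (‖entry v (2 * N)‖ * ‖y₂‖ ^ N) := by gcongr
          _ = ‖entry v (2 * N)‖ * (‖1 - y₁‖ * ‖y₂‖ ^ N) := by ring
          _ ≤ _ := by rw [e]; gcongr
      have hK'0 : 0 < K' := by linarith
      rw [div_mul_eq_mul_div, div_le_iff₀ hK'0] at l1
      linarith
    have hyr : 1 ≤ ‖y₂‖ * r := by
      have : (1 + δ) * r ≤ ‖y₂‖ * r := by gcongr
      rw [hr] at this ⊢
      nlinarith
    obtain ⟨n, hn⟩ : ∃ n, N = k + n := ⟨N - k, by omega⟩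
    have hpow : ‖y₂‖ ^ k ≤ ‖y₂‖ ^ N * r ^ n := by
      rw [hn, pow_add, mul_assoc, ← mul_pow]
      exact le_mul_of_one_le_right (by positivity) (one_le_pow₀ hyr)
    rw [hjk, entry_rev_eq_edgeVal hγ h.2 (by omega) (by omega), norm_mul]
    have hj' : 2 * N + 1 - k = N + n + 1 := by omega
    rw [hj']
    -- The estimate yields the exponent `N + n = j - 1`; the missing factor `r` costs the constant
    -- `2`.
    have hhalf : 1 ≤ 2 * r := by rw [hr]; linarith
    calc ‖edgeVal q (scaled (-θ) γ lam) k‖ * ‖entry v (2 * N)‖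
        ≤ K' * ‖y₂‖ ^ k * ‖entry v (2 * N)‖ := by
          gcongr; exact hy.norm_edgeVal_le_pow hq (by linarith) k
      _ ≤ K' * (‖y₂‖ ^ N * r ^ n) * ‖entry v (2 * N)‖ := by gcongr
      _ = K' * r ^ n * (‖entry v (2 * N)‖ * ‖y₂‖ ^ N) := by ring
      _ ≤ K' * r ^ n * (K' * K * r ^ N * ‖entry v 1‖) := by gcongr
      _ = K * K' ^ 2 * r ^ (N + n) * ‖entry v 1‖ * 1 := by rw [pow_add]; ring
      _ ≤ K * K' ^ 2 * r ^ (N + n) * ‖entry v 1‖ * (2 * r) := by gcongr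
      _ = _ := by rw [pow_succ]; ring

/-- The choice `B = -2 log r / γ` turns the geometric rate `r^j` into the stated exponential. -/
lemma exp_rate {γ r : ℝ} (hγ : 0 < γ) (hr : 0 < r) (j : ℕ) :
    Real.exp (-(-(2 * Real.log r) / γ * (j * γ / 2))) = r ^ j := by
  rw [show -(-(2 * Real.log r) / γ * (j * γ / 2)) = j * Real.log r by field_simp,
    Real.exp_nat_mul, Real.exp_log hr]

lemma exp_rate_pos {γ r : ℝ} (hγ : 0 < γ) (hr : 0 < r) (hr1 : r < 1) :
    0 < -(2 * Real.log r) / γ :=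
  div_pos (by linarith [Real.log_neg hr hr1]) hγ

lemma exists_decay_inter {γ σ : ℝ} (hγ : 0 < γ) (hσ : 0 < σ) (θ : ℝ) :
    ∃ B C : ℝ, 0 < B ∧ 0 < C ∧ ∀ N ≥ 1, ∀ (lam : ℂ) (v : Fin (2 * N) → ℂ),
      IsEigenpair N θ γ lam v →
      lam ∈ (regionUpper θ γ ∩ regionLower θ γ) \ boundaryLayer θ γ σ →
      ∀ j : ℕ, 1 ≤ j → j ≤ N →
        ‖entry v j‖ < C * Real.exp (-(B * (j * γ / 2))) * ‖entry v 1‖ ∧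
        ‖entry v (2 * N + 1 - j)‖ <
          C * Real.exp (-(B * (j * γ / 2))) * ‖entry v (2 * N)‖ := by
  have hq := one_lt_exp hγ
  have hδ := rootGap_pos hγ hσ
  have hδ2 := rootGap_le γ σ
  set δ := rootGap γ σ with hδd
  have hr0 : 0 < 1 - δ / 2 := by linarith
  -- The added `1` makes the inequality strict, as the edge entries are nonzero.
  refine ⟨-(2 * Real.log (1 - δ / 2)) / γ, 4 / δ + 1, exp_rate_pos hγ hr0 (by linarith),
    by positivity, ?_⟩
  rintro N - lam v hv ⟨⟨hu, hd⟩, hl⟩ j hj hjN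
  obtain ⟨hl1, hl2⟩ := notMem_thickening_of_notMem_boundaryLayer hl
  rw [regionLower_eq] at hd
  obtain ⟨z₁, z₂, hz⟩ := exists_charRoots hq (scaled θ γ lam)
  obtain ⟨y₁, y₂, hy⟩ := exists_charRoots hq (scaled (-θ) γ lam)
  have hz2 := hz.norm_edgeVal_le hq hδ (norm_root_le_of_mem hγ hz hl1 hu) j
  have hy2 := hy.norm_edgeVal_le hq hδ (norm_root_le_of_mem hγ hy hl2 hd) j
  have hp : 0 < (1 - δ / 2) ^ j := by positivity
  rw [exp_rate hγ hr0, entry_eq_edgeVal hγ hv.2 hj (by omega),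
    entry_rev_eq_edgeVal hγ hv.2 hj (by omega), norm_mul, norm_mul]
  exact ⟨mul_lt_mul_of_pos_right (by linarith) (norm_pos_iff.2 (hv.entry_one_ne_zero hγ)),
    mul_lt_mul_of_pos_right (by linarith) (norm_pos_iff.2 (hv.entry_last_ne_zero hγ))⟩

lemma exists_decay_symmDiff {γ σ : ℝ} (hγ : 0 < γ) (hσ : 0 < σ) (θ : ℝ) :
    ∃ B C : ℝ, 0 < B ∧ 0 < C ∧ ∀ N ≥ 1, ∀ (lam : ℂ) (v : Fin (2 * N) → ℂ),
      IsEigenpair N θ γ lam v →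
      lam ∈ symmDiff (regionUpper θ γ) (regionLower θ γ) \ boundaryLayer θ γ σ →
      (lam ∈ regionUpper θ γ → ∀ j : ℕ, 1 ≤ j → j ≤ 2 * N →
        ‖entry v j‖ < C * Real.exp (-(B * (j * γ / 2))) * ‖entry v 1‖) ∧
      (lam ∈ regionLower θ γ → ∀ j : ℕ, 1 ≤ j → j ≤ 2 * N →
        ‖entry v (2 * N + 1 - j)‖ <
          C * Real.exp (-(B * (j * γ / 2))) * ‖entry v (2 * N)‖) := by
  have hq := one_lt_exp hγ
  have hδ := rootGap_pos hγ hσ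
  have hδ2 := rootGap_le γ σ
  set δ := rootGap γ σ with hδd
  have hr0 : 0 < 1 - δ / 2 := by linarith
  have hq1 : 0 < Real.exp γ - 1 := by linarith
  set M := 2 * (4 / δ) * (2 * Real.exp γ / (Real.exp γ - 1)) ^ 2 with hM
  have hM0 : 0 < M := by positivity
  refine ⟨-(2 * Real.log (1 - δ / 2)) / γ, M + 1, exp_rate_pos hγ hr0 (by linarith),
    by positivity, ?_⟩
  rintro N - lam v hv ⟨hs, hl⟩
  obtain ⟨hl1, hl2⟩ := notMem_thickening_of_notMem_boundaryLayer hl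
  rw [Set.mem_symmDiff] at hs
  rw [regionLower_eq] at hs ⊢
  obtain ⟨z₁, z₂, hz⟩ := exists_charRoots hq (scaled θ γ lam)
  obtain ⟨y₁, y₂, hy⟩ := exists_charRoots hq (scaled (-θ) γ lam)
  refine ⟨fun hm j hj hjN => ?_, fun hm j hj hjN => ?_⟩
  · have hn : lam ∉ regionUpper (-θ) γ := by tauto
    have hb := hv.norm_entry_le hγ hz hy hδ hδ2 (norm_root_le_of_mem hγ hz hl1 hm)
      (le_norm_root_of_notMem hγ hy hl2 hn) hj hjN
    have hp : 0 < (1 - δ / 2) ^ j * ‖entry v 1‖ :=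
      mul_pos (by positivity) (norm_pos_iff.2 (hv.entry_one_ne_zero hγ))
    rw [exp_rate hγ hr0]
    linarith
  · have hn : lam ∉ regionUpper θ γ := by tauto
    have hb := hv.rev.norm_entry_le hγ hy (by rwa [neg_neg]) hδ hδ2
      (norm_root_le_of_mem hγ hy hl2 hm) (le_norm_root_of_notMem hγ hz hl1 hn) hj hjN
    rw [entry_rev v j hj, entry_rev v 1 le_rfl, Nat.add_sub_cancel] at hb
    have hp : 0 < (1 - δ / 2) ^ j * ‖entry v (2 * N)‖ :=
      mul_pos (by positivity) (norm_pos_iff.2 (hv.entry_last_ne_zero hγ))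
    rw [exp_rate hγ hr0]
    linarith

end GaugeCapacitance

theorem theorem5p2 (γ θ σ : ℝ) (hγ : 0 < γ) (hσ : 0 < σ) :
    (0 < θ → θ < Real.pi / 2 →
      -- exactly one of the three cases occurs, for all large `N`
      (∃ N₀ : ℕ, ∀ N ≥ N₀, ∀ (lam : ℂ) (v : Fin (2 * N) → ℂ),
        GaugeCapacitance.IsEigenpair N θ γ lam v →
          lam ∈ GaugeCapacitance.boundaryLayer θ γ σ ∨
          lam ∈ (GaugeCapacitance.regionUpper θ γ ∩ GaugeCapacitance.regionLower θ γ) \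
            GaugeCapacitance.boundaryLayer θ γ σ ∨
          lam ∈ symmDiff (GaugeCapacitance.regionUpper θ γ) (GaugeCapacitance.regionLower θ γ) \
            GaugeCapacitance.boundaryLayer θ γ σ) ∧
      -- case (1): `0` lies in the boundary layer, and its eigenvectors are the constant ones
      ((0 : ℂ) ∈ GaugeCapacitance.boundaryLayer θ γ σ ∧
        ∀ N : ℕ, ∀ v : Fin (2 * N) → ℂ,
          (GaugeCapacitance.genCapMatrix N θ γ).mulVec v = 0 ↔ ∃ c : ℂ, v = fun _ => c) ∧
      -- case (2): exponential decay from both edges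
      (∃ B C : ℝ, 0 < B ∧ 0 < C ∧ ∀ N ≥ 1, ∀ (lam : ℂ) (v : Fin (2 * N) → ℂ),
        GaugeCapacitance.IsEigenpair N θ γ lam v →
        lam ∈ (GaugeCapacitance.regionUpper θ γ ∩ GaugeCapacitance.regionLower θ γ) \
            GaugeCapacitance.boundaryLayer θ γ σ →
          ∀ j : ℕ, 1 ≤ j → j ≤ N →
            ‖GaugeCapacitance.entry v j‖ <
              C * Real.exp (-(B * (j * γ / 2))) * ‖GaugeCapacitance.entry v 1‖ ∧
            ‖GaugeCapacitance.entry v (2 * N + 1 - j)‖ <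
              C * Real.exp (-(B * (j * γ / 2))) * ‖GaugeCapacitance.entry v (2 * N)‖) ∧
      -- case (2): the dominating edge, for all large `N`
      (∃ N₀ : ℕ, ∀ N ≥ N₀, ∀ (lam : ℂ) (v : Fin (2 * N) → ℂ),
        GaugeCapacitance.IsEigenpair N θ γ lam v →
        lam ∈ (GaugeCapacitance.regionUpper θ γ ∩ GaugeCapacitance.regionLower θ γ) \
            GaugeCapacitance.boundaryLayer θ γ σ →
          (0 ≤ lam.im →
            ‖GaugeCapacitance.entry v (2 * N)‖ ≤ ‖GaugeCapacitance.entry v 1‖) ∧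
          (lam.im ≤ 0 →
            ‖GaugeCapacitance.entry v 1‖ ≤ ‖GaugeCapacitance.entry v (2 * N)‖)) ∧
      -- case (2): symmetry of the moduli for real eigenvalues
      (∀ N ≥ 1, ∀ (lam : ℝ) (v : Fin (2 * N) → ℂ),
        GaugeCapacitance.IsEigenpair N θ γ (lam : ℂ) v →
          ∀ j : ℕ, 1 ≤ j → j ≤ N →
            ‖GaugeCapacitance.entry v j‖ = ‖GaugeCapacitance.entry v (2 * N + 1 - j)‖) ∧
      -- case (3): condensation at one edge
      (∃ B C : ℝ, 0 < B ∧ 0 < C ∧ ∀ N ≥ 1, ∀ (lam : ℂ) (v : Fin (2 * N) → ℂ),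
        GaugeCapacitance.IsEigenpair N θ γ lam v →
        lam ∈ symmDiff (GaugeCapacitance.regionUpper θ γ) (GaugeCapacitance.regionLower θ γ) \
            GaugeCapacitance.boundaryLayer θ γ σ →
          (lam ∈ GaugeCapacitance.regionUpper θ γ →
            ∀ j : ℕ, 1 ≤ j → j ≤ 2 * N →
              ‖GaugeCapacitance.entry v j‖ <
                C * Real.exp (-(B * (j * γ / 2))) * ‖GaugeCapacitance.entry v 1‖) ∧
          (lam ∈ GaugeCapacitance.regionLower θ γ →
            ∀ j : ℕ, 1 ≤ j → j ≤ 2 * N →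
              ‖GaugeCapacitance.entry v (2 * N + 1 - j)‖ <
                C * Real.exp (-(B * (j * γ / 2))) *
                  ‖GaugeCapacitance.entry v (2 * N)‖))) ∧
    -- case (2) never occurs for `π / 4 ≤ θ ≤ π / 2` and large `N`
    (Real.pi / 4 ≤ θ → θ ≤ Real.pi / 2 →
      ∃ N₀ : ℕ, ∀ N ≥ N₀, ∀ (lam : ℂ) (v : Fin (2 * N) → ℂ),
        GaugeCapacitance.IsEigenpair N θ γ lam v →
          lam ∉ (GaugeCapacitance.regionUpper θ γ ∩ GaugeCapacitance.regionLower θ γ) \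
            GaugeCapacitance.boundaryLayer θ γ σ) := by
  refine ⟨fun h0 h1 => ⟨?_, ⟨GaugeCapacitance.zero_mem_boundaryLayer hγ hσ θ,
    fun N v => GaugeCapacitance.mulVec_eq_zero_iff hγ N θ v⟩,
    GaugeCapacitance.exists_decay_inter hγ hσ θ,
    -- The dominating edge needs neither large `N` nor the position of `lam` relative to the
    -- regions.
    ⟨0, fun N _ lam v hv _ =>
      ⟨fun him => hv.norm_last_le hγ h0 h1 him, fun him => hv.norm_one_le hγ h0 h1 him⟩⟩,
    fun N _ lam v hv j hj hjN => hv.norm_symm hγ h0 h1 hj hjN,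
    GaugeCapacitance.exists_decay_symmDiff hγ hσ θ⟩,
    fun h1 h2 => GaugeCapacitance.exists_notMem_inter hγ hσ h1 h2⟩
  obtain ⟨N₀, hN₀⟩ := GaugeCapacitance.exists_mem_region hγ hσ θ
  refine ⟨N₀, fun N hN lam v hv => ?_⟩
  have := hN₀ N hN lam v hv
  simp only [Set.mem_sdiff, Set.mem_inter_iff, Set.mem_symmDiff]
  tauto
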